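/- **Setting.** Let $\mathcal X$ be a finite alphabet with an end symbol $\bot\in\mathcal X$, let $U$ be a finite set of users, and let each user $j\in U$ hold a finite multiset $S_j$ of strings over $\mathcal X$. Two datasets $(S_j)_{j\in U}$, $(S'_j)_{j\in U}$ are *item-level neighbours* if they differ by replacing exactly one contribution (one element, counted once) of one user. A randomized algorithm $\mathcal A$ is $(\varepsilon',\delta)$-*centrally DP at item level* if $\Pr[\mathcal A(\mathbf S)\in O]\le e^{\varepsilon'}\Pr[\mathcal A(\mathbf S')\in O]+\delta$ for all item-level neighbours $\mathbf S,\mathbf S'$ and all events $O$. **Subset selection.** For a finite set $\mathcal Z$ with $s=|\mathcal Z|$ and $z\in\mathcal Z$, put $d=\lceil s/(e^{\varepsilon}+1)\rceil$ and $p=\frac{de^{\varepsilon}}{de^{\varepsilon}+s-d}$. With probability $p$, $\mathrm{SS}(z,\mathcal Z,\varepsilon)$ returns $\{z\}$ together with a uniformly random $(d-1)$-subset of $\mathcal Z\setminus\{z\}$; otherwise it returns a uniformly random $d$-subset of $\mathcal Z\setminus\{z\}$. **Algorithm (LDP TrieHH).** The parameters are the depth $D$, the number $N\ge1$ of users per layer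 with $DN\le |U|$, the contribution bound $B\ge 1$, the maximum number of prefixes $\eta_{\max}\ge1$, a finite set $\mathcal V$ of known words, and $\varepsilon\ge 0$. Start with $P_0=\mathcal X$. In layer $i=1,\dots,D$, draw a set $U_i$ of $N$ users that have not participated before, by any rule that does not depend on the data, and let $\mathcal Z_i=\{\mathbf zx:\mathbf z\in P_{i-1},\,x\in\mathcal X\}$. Each user $j\in U_i$ forms the multiset of those prefixes $\mathbf z[:i+1]$ of length $i+1$, for $\mathbf z\in S_j$ with $\mathbf z\notin\mathcal V$, that lie in $\mathcal Z_i$, and samples $B$ elements from it: either the $B$ distinct elements of largest multiplicity (*GreedySampling*; ties are broken by an order that is fixed or drawn independently of the data) or a uniformly random set of $B$ distinct elements (*RandomSampling*). If there are fewer than $B$ distinct elements, all of them are taken and copies of a dummy element $\gamma$ are added until there are $B$ elements. The user applies $\mathrm{SS}(\cdot,\mathcal Z_i\cup\{\gamma\},\varepsilon)$ independently to each of the $B$ elements and sends the sum $\mathbf v_j$ of the indicator vectors on $\mathcal Z_i$ of the reported subsets. With $\mathbf v=\sum_{j\in U_i}\mathbf v_j$ and $\tau_i$ the $\eta_{\max}$-th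 largest entry of $\mathbf v$ ($\tau_i=0$ if there are fewer entries), set $P_i=\{\mathbf z\in\mathcal Z_i:\mathbf v[\mathbf z]\ge\tau_i\}$. The final output $H$ is the set of all elements of $P_1\cup\dots\cup P_D$ whose last character is $\bot$. **Amplification parameter.** For $n\ge1$ let $C\sim\mathrm{Bin}\bigl(n-1,\tfrac{2}{e^{\varepsilon}+1}\bigr)$, let $A\sim\mathrm{Bin}(C,\tfrac12)$ given $C$, and let $\Delta\sim\mathrm{Bern}\bigl(\tfrac{e^{\varepsilon}}{e^{\varepsilon}+1}\bigr)$ be independent of $(A,C)$. Let $\varepsilon'=\varepsilon'(\varepsilon,n,\delta)$ be the least $t\ge0$ such that the laws $Q_0$ of $(A+\Delta,\;C-A+1-\Delta)$ and $Q_1$ of $(A+1-\Delta,\;C-A+\Delta)$ satisfy $Q_0(O)\le e^tQ_1(O)+\delta$ and $Q_1(O)\le e^tQ_0(O)+\delta$ for every event $O$. **Theorem.** Let $n=NB$ and $\delta\in[0,1]$. With either GreedySampling or RandomSampling as the local sampler, the joint output $(P_1,\dots,P_D,H)$ of the algorithm is $(\varepsilon',\delta)$-centrally DP at item level with $\varepsilon'=\varepsilon'(\varepsilon,n,\delta)$.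 If moreover $\delta>0$, $\frac{n}{8\ln(2/\delta)}-1>0$ and $\varepsilon\le\ln\!\left(\frac{n}{8\ln(2/\delta)}-1\right)$, then $$\varepsilon'\le\ln\!\left(1+(e^{\varepsilon}-1)\left(\frac{4\sqrt{2\ln(4/\delta)}}{\sqrt{(e^{\varepsilon}+1)n}}+\frac4n\right)\right).$$ -/

import Mathlib

noncomputable section

/-! ## Indistinguishability and central differential privacy -/

/-- `p(O) ≤ e ^ t * q(O) + δ` for every event `O`. -/
def DominatedBy {Ω : Type*} (t δ : ℝ) (p q : PMF Ω) : Prop :=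
  ∀ O : Set Ω,
    p.toOuterMeasure O ≤ ENNReal.ofReal (Real.exp t) * q.toOuterMeasure O + ENNReal.ofReal δ

/-- `(ε, δ)`-differential privacy of the randomized algorithm `A` with respect to the
neighbouring relation `nbr`. -/
def IsDP {𝒮 Ω : Type*} (nbr : 𝒮 → 𝒮 → Prop) (ε δ : ℝ) (A : 𝒮 → PMF Ω) : Prop :=
  ∀ S S' : 𝒮, nbr S S' → DominatedBy ε δ (A S) (A S')

/-- Item-level neighbours in the swap model: the local datasets are multisets of contributions
and exactly one contribution of one user is replaced. -/
def ItemNeighbours {U Z : Type*} (S S' : U → Multiset Z) : Prop :=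
  ∃ (j : U) (M : Multiset Z) (z z' : Z),
    S j = z ::ₘ M ∧ S' j = z' ::ₘ M ∧ ∀ k, k ≠ j → S k = S' k

/-! ## Elementary random draws -/

/-- A coin that shows `true` with probability `p`, for `0 ≤ p ≤ 1`. -/
def coin (p : ℝ) : PMF Bool :=
  PMF.ofFintype
    (fun b => if b then min (ENNReal.ofReal p) 1 else 1 - min (ENNReal.ofReal p) 1)
    (by simp)

/-- A uniformly random subset of `T` with `k` elements (all of `T` if it has fewer). -/
def uniformSubset {α : Type*} (k : ℕ) (T : Finset α) : PMF (Finset α) :=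
  PMF.uniformOfFinset (T.powersetCard (min k T.card))
    (Finset.powersetCard_nonempty.2 (min_le_right _ _))

/-- The law of the sum of independent draws, one from each law in the list. -/
def indepSum {M : Type*} [AddMonoid M] (l : List (PMF M)) : PMF M :=
  l.foldr (fun p q => p.bind fun a => q.map fun b => a + b) (PMF.pure 0)

/-- The binomial distribution: the number of successes in `m` independent trials with success
probability `p`, for `0 ≤ p ≤ 1`. -/
def binomialLaw (m : ℕ) (p : ℝ) : PMF ℕ :=
  indepSum (List.replicate m ((coin p).map fun b => if b then 1 else 0))

/-! ## The numerical privacy parameter of amplification by shuffling -/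

/-- The law of `(A + Δ, C - A + 1 - Δ)`, where `C ∼ Bin(n - 1, 2 / (e ^ ε + 1))`,
`A ∼ Bin(C, 1 / 2)` given `C`, and `Δ ∼ Bern(e ^ ε / (e ^ ε + 1))` is independent of `(A, C)`. -/
def shufflePair₀ (ε : ℝ) (n : ℕ) : PMF (ℕ × ℕ) :=
  (binomialLaw (n - 1) (2 / (Real.exp ε + 1))).bind fun C =>
    (binomialLaw C (1 / 2)).bind fun A =>
      (coin (Real.exp ε / (Real.exp ε + 1))).map fun Δ =>
        if Δ then (A + 1, C - A) else (A, C - A + 1)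

/-- The law of `(A + 1 - Δ, C - A + Δ)`, with `A`, `C`, `Δ` as in `shufflePair₀`. -/
def shufflePair₁ (ε : ℝ) (n : ℕ) : PMF (ℕ × ℕ) :=
  (shufflePair₀ ε n).map Prod.swap

/-- The central privacy parameter at `δ` that amplification by shuffling assigns to `n` reports
of `ε`-LDP randomizers: the least `t ≥ 0` for which the two laws above are
`(t, δ)`-indistinguishable. -/
def shuffleEps (ε : ℝ) (n : ℕ) (δ : ℝ) : ℝ :=
  sInf {t : ℝ | 0 ≤ t ∧ DominatedBy t δ (shufflePair₀ ε n) (shufflePair₁ ε n) ∧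
    DominatedBy t δ (shufflePair₁ ε n) (shufflePair₀ ε n)}

/-! ## Subset selection -/

/-- The size `d = ⌈s / (e ^ ε + 1)⌉` of the reported subsets, where `s` is the domain size. -/
def ssSize (ε : ℝ) (s : ℕ) : ℕ := ⌈(s : ℝ) / (Real.exp ε + 1)⌉₊

/-- The probability `p = d e ^ ε / (d e ^ ε + s - d)` with which the input is reported. -/
def ssProb (ε : ℝ) (s : ℕ) : ℝ :=
  (ssSize ε s : ℝ) * Real.exp ε / ((ssSize ε s : ℝ) * Real.exp ε + s - ssSize ε s)

/-- The subset selection randomizer `SS(z, 𝒵, ε)`. -/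
def subsetSelection {α : Type*} [DecidableEq α] (ε : ℝ) (𝒵 : Finset α) (z : α) :
    PMF (Finset α) :=
  (coin (ssProb ε 𝒵.card)).bind fun hit =>
    if hit then
      (uniformSubset (ssSize ε 𝒵.card - 1) (𝒵.erase z)).map (insert z)
    else
      uniformSubset (ssSize ε 𝒵.card) (𝒵.erase z)

/-! ## Local samplers

Below, `Option Y` is `Y` together with the dummy element `γ = none`. -/

/-- The two local samplers. Greedy sampling breaks ties between elements that are contributed
equally often in favour of the smaller key, where the (injective) key is drawn from a law that
does not depend on the data: a point mass for a fixed order of the elements, or a random order. -/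
inductive LocalSampler (Y : Type*) where
  | greedy (tie : PMF (Y ↪ ℕ)) : LocalSampler Y
  | random : LocalSampler Y

/-- The (at most) `B` distinct elements of `M` with the largest multiplicities. -/
def topElements {Y : Type*} [DecidableEq Y] (key : Y ↪ ℕ) (B : ℕ) (M : Multiset Y) : Finset Y :=
  M.toFinset.filter fun z =>
    (M.toFinset.filter fun w =>
      M.count z < M.count w ∨ (M.count w = M.count z ∧ key w < key z)).card < B

/-- Copies of `γ` are added to the set `T` until there are `B` elements. -/
def padWithDummy {Y : Type*} (B : ℕ) (T : Finset Y) : List (Option Y) :=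
  T.toList.map some ++ List.replicate (B - T.card) none

/-- `Sample(M, B)`: the list of the `B` sampled elements of the local dataset `M`. -/
def LocalSampler.sample {Y : Type*} [DecidableEq Y] (smp : LocalSampler Y) (B : ℕ)
    (M : Multiset Y) : PMF (List (Option Y)) :=
  match smp with
  | .greedy tie => tie.map fun key => padWithDummy B (topElements key B M)
  | .random => (uniformSubset B M.toFinset).map (padWithDummy B)

/-! ## LDP TrieHH

Elements are strings `List X` over the finite alphabet `X`. -/

/-- The parameters of the algorithm. -/
structure TrieParams (X : Type*) where
  /-- the end of sequence symbol -/
  bot : X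
  /-- the known words -/
  known : Finset (List X)
  /-- the user contribution bound -/
  B : ℕ
  /-- the per-layer maximum prefix -/
  ηmax : ℕ
  /-- the LDP parameter -/
  ε : ℝ
  /-- the local sampler -/
  sampler : LocalSampler (List X)

section TrieHH

variable {X : Type*} [Fintype X] [DecidableEq X]

/-- The one-character extensions `{𝐳x | 𝐳 ∈ P, x ∈ 𝒳}` of the prefixes in `P`. -/
def extensions (P : Finset (List X)) : Finset (List X) :=
  Finset.image₂ (fun z x => z ++ [x]) P Finset.univ

/-- The prefixes `𝐳[:i+1]` in the domain `𝒵` of the contributed elements `𝐳` that are not known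
words, with multiplicities. -/
def localPrefixes (known : Finset (List X)) (𝒵 : Finset (List X)) (i : ℕ)
    (S : Multiset (List X)) : Multiset (List X) :=
  ((S.filter fun z => z ∉ known).map fun z => z.take (i + 1)).filter fun y => y ∈ 𝒵

/-- The 0/1 vote vector on `𝒵` (extended by zero) of a reported subset of `𝒵 ∪ {γ}`. -/
def multiHot (𝒵 : Finset (List X)) (R : Finset (Option (List X))) : List X → ℕ :=
  fun z => if z ∈ 𝒵 ∧ some z ∈ R then 1 else 0

/-- The vote vector `𝐯_j` that a user with local dataset `S` sends in layer `i`. -/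
def userVote (par : TrieParams X) (i : ℕ) (𝒵 : Finset (List X)) (S : Multiset (List X)) :
    PMF (List X → ℕ) :=
  (par.sampler.sample par.B (localPrefixes par.known 𝒵 i S)).bind fun T =>
    indepSum (T.map fun z => (subsetSelection par.ε (Finset.insertNone 𝒵) z).map (multiHot 𝒵))

/-- The `η`-th largest entry of the vector `v` on `𝒵` (`0` if there are fewer entries). -/
def threshold (η : ℕ) (𝒵 : Finset (List X)) (v : List X → ℕ) : ℕ :=
  ((𝒵.val.map v).sort (fun a b => b ≤ a)).getD (η - 1) 0

/-- Layer `i`: from the previous heavy prefixes `P` and the cohort `c`, the aggregated votes of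
the cohort and then the new heavy prefixes. -/
def layer {U : Type*} (par : TrieParams X) (S : U → Multiset (List X)) (i : ℕ)
    (P : Finset (List X)) (c : Finset U) : PMF (Finset (List X)) :=
  (indepSum (c.toList.map fun j => userVote par i (extensions P) (S j))).map fun v =>
    (extensions P).filter fun z => threshold par.ηmax (extensions P) v ≤ v z

/-- `k` further layers, starting with layer `i`, when the users in `used` have already
participated and `P` is the current set of heavy prefixes. The cohort of a layer is drawn by
`pick`. The result is the list of the sets of heavy prefixes found in these layers. -/
def layers {U : Type*} [DecidableEq U] (par : TrieParams X) (pick : Finset U → PMF (Finset U))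
    (S : U → Multiset (List X)) : ℕ → ℕ → Finset U → Finset (List X) →
      PMF (List (Finset (List X)))
  | 0, _, _, _ => PMF.pure []
  | k + 1, i, used, P =>
      (pick used).bind fun c =>
        (layer par S i P c).bind fun P' =>
          (layers par pick S k (i + 1) (used ∪ c) P').map fun Ps => P' :: Ps

/-- The heavy hitters: the elements of the sets in the list that end with the end symbol. -/
def heavyHitters (bot : X) (Ps : List (Finset (List X))) : Finset (List X) :=
  Ps.foldl (fun H P => H ∪ P.filter fun z => z.getLast? = some bot) ∅

/-- LDP TrieHH of depth `D`, started with `P₀ = 𝒳`, on the local datasets `S`. The output is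
`([P₁, …, P_D], H)`. -/
def trieHH {U : Type*} [DecidableEq U] (par : TrieParams X) (D : ℕ)
    (pick : Finset U → PMF (Finset U)) (S : U → Multiset (List X)) :
    PMF (List (Finset (List X)) × Finset (List X)) :=
  (layers par pick S D 1 ∅ (Finset.univ.image fun x => [x])).map fun Ps =>
    (Ps, heavyHitters par.bot Ps)

end TrieHH

/-- As long as `N` users are left, `pick used` is the law of a set of `N` users that have not
participated before (for example, of a uniformly random one). -/
def PicksFreshCohorts {U : Type*} [Fintype U] (N : ℕ) (pick : Finset U → PMF (Finset U)) : Prop :=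
  ∀ used : Finset U, used.card + N ≤ Fintype.card U →
    ∀ c ∈ (pick used).support, c.card = N ∧ Disjoint c used

end

/-!
Privacy amplification by shuffling carries the theorem. A layer of the algorithm is a sum of
`n = N * B` independent subset selection reports, and replacing one contribution of one user changes
the input of at most one of them.

**One changed input.** A finitely supported signed measure on a commutative monoid is an element
of the convolution algebra `ℝ[M]`, and the law of a sum of reports is a product in it. Let `μ₀`,
`μ₁` be the laws of the changed report and let the other reports have laws `νᵢ`, all of them
pointwise within a factor `e ^ ε` of `μ₀` and `μ₁` (`pointwiseClose_subsetSelection`). Then the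
*blanket* `B = e ^ (-ε) max(μ₀, μ₁)` lies below every `νᵢ`, and `w = μ₀ - e ^ t μ₁` has a density
`X` with respect to `B`. Weighting by an additive function is a derivation of the convolution
algebra (`weightBy_mul`), so `k w B ^ (k - 1)` is the weighting of the law of a sum of `k` blanket
samples by `X₁ + ⋯ + X_k`. Expanding `∏ (B + (νᵢ - B))` gives `expect_mul_prod_le`: the masses
that `w ∏ νᵢ` assigns to events are at most `(1 / n) 𝔼 (X₁ + ⋯ + Xₙ)⁺`, where now each `Xᵢ` is
extended by `0` to the mass which `B` lacks.

**The worst case is binary randomized response.** For a convex function `φ`, the chords of `φ` on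
`[-(e ^ (t + ε) - 1), 0]` and `[0, e ^ ε - e ^ t]` bound `𝔼 φ(Xᵢ)` by the expectation under the
three-point law that belongs to binary randomized response (`sum_blanket_le`); replacing the
summands one by one (`expect_pow_le`) yields `shuffle_bound`. The same derivation property, read
backwards, identifies the resulting bound with the mass that `Q₀ - e ^ t Q₁` assigns to an event,
where `Q₀`, `Q₁` are the laws in the definition of `shuffleEps` (`expect_threePoint_pow`). Hence
every `t ≥ 0` that works for `Q₀` and `Q₁` works for the sums of reports
(`dominatedBy_of_shufflePair`). The least such `t` exists because the condition is closed in `t`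
(`dominatedBy_shuffleEps`).

**From one report to the algorithm.** Both samplers have sensitivity one in distribution: the
sample is, up to order, a core of `B - 1` elements whose law does not involve the changed
contribution, together with one further element (`exists_sample_eq_cons`). For random sampling
this is a coupling of uniform subsets of `S` and `S ∪ {a}`. Conditioning on everything but the
further element leaves two sums that differ in one report. A user takes part in at most one layer,
so the layers before and after that one are common randomness and post-processing
(`dominatedBy_layers`).

**The closed form.** The ratio `Q₀ / Q₁` at the counts `(a, b)` is
`(e ^ ε a + b) / (a + e ^ ε b)`. Outside an event of probability `δ`, the number of
clones is at least half its mean (a Chernoff bound) and they split almost evenly (Hoeffding's inequality), which bounds the ratio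
(`shuffleEps_le_log`).
-/

open AddMonoidAlgebra

/-! ### Finitely supported signed measures -/

section Expect

variable {M N V : Type*} [AddCommGroup V] [Module ℝ V]

/-- The expectation `∑ a(m) • f(m)` of a (possibly vector-valued) function `f` under the finitely
supported signed measure `a` on `M`, which is regarded as an element of the convolution algebra
`ℝ[M]`. -/
noncomputable def expect (f : M → V) : ℝ[M] →ₗ[ℝ] V :=
  Finsupp.linearCombination ℝ f ∘ₗ (coeffLinearEquiv ℝ).toLinearMap

@[simp]
theorem expect_single (f : M → V) (m : M) (r : ℝ) : expect f (single m r) = r • f m := by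
  simp [expect]

theorem expect_eq_sum (f : M → V) (a : ℝ[M]) :
    expect f a = ∑ m ∈ a.coeff.support, a.coeff m • f m := by
  simp [expect, Finsupp.linearCombination_apply, Finsupp.sum]

theorem expect_add_left (f g : M → V) (a : ℝ[M]) :
    expect (fun m => f m + g m) a = expect f a + expect g a := by
  simp [expect_eq_sum, Finset.sum_add_distrib]

theorem expect_smul_left (c : ℝ) (f : M → V) (a : ℝ[M]) :
    expect (fun m => c • f m) a = c • expect f a := by
  simp only [expect_eq_sum, Finset.smul_sum, smul_comm c]

theorem expect_mapDomain (f : N → V) (g : M → N) (a : ℝ[M]) :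
    expect f (mapDomain g a) = expect (f ∘ g) a := by
  induction a using AddMonoidAlgebra.induction_linear with
  | zero => simp
  | add x y hx hy => simp [mapDomain_add, hx, hy]
  | single m r => simp

theorem coeff_expect (f : M → ℝ[N]) (a : ℝ[M]) (x : N) :
    (expect f a).coeff x = expect (fun m => (f m).coeff x) a := by
  simp [expect_eq_sum, Finsupp.finsetSum_apply]

theorem expect_expect (g : N → V) (f : M → ℝ[N]) (a : ℝ[M]) :
    expect g (expect f a) = expect (fun m => expect g (f m)) a := by
  simp [expect_eq_sum f, expect_eq_sum (fun m => expect g (f m))]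

/-- A finitely supported measure without negative masses. -/
def NonnegMeasure (a : ℝ[M]) : Prop := ∀ m, 0 ≤ a.coeff m

theorem NonnegMeasure.expect_mono {a : ℝ[M]} (ha : NonnegMeasure a) {f g : M → ℝ}
    (h : ∀ m, f m ≤ g m) : expect f a ≤ expect g a := by
  rw [expect_eq_sum, expect_eq_sum]
  exact Finset.sum_le_sum fun m _ => mul_le_mul_of_nonneg_left (h m) (ha m)

theorem NonnegMeasure.expect_nonneg {a : ℝ[M]} (ha : NonnegMeasure a) {f : M → ℝ}
    (h : ∀ m, 0 ≤ f m) : 0 ≤ expect f a := by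
  rw [expect_eq_sum]
  exact Finset.sum_nonneg fun m _ => mul_nonneg (ha m) (h m)

theorem nonnegMeasure_single (m : M) {r : ℝ} (hr : 0 ≤ r) : NonnegMeasure (single m r : ℝ[M]) := by
  classical
  intro x
  simp only [coeff_single, Finsupp.single_apply]
  split_ifs <;> simp [hr]

theorem NonnegMeasure.add {a b : ℝ[M]} (ha : NonnegMeasure a) (hb : NonnegMeasure b) :
    NonnegMeasure (a + b) := fun m => by simpa using add_nonneg (ha m) (hb m)

theorem NonnegMeasure.sum {ι : Type*} {s : Finset ι} {a : ι → ℝ[M]}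
    (ha : ∀ i ∈ s, NonnegMeasure (a i)) : NonnegMeasure (∑ i ∈ s, a i) := fun m => by
  simpa [Finsupp.finsetSum_apply] using Finset.sum_nonneg fun i hi => ha i hi m

theorem NonnegMeasure.expect {a : ℝ[M]} (ha : NonnegMeasure a) {f : M → ℝ[N]}
    (hf : ∀ m, NonnegMeasure (f m)) : NonnegMeasure (expect f a) := fun x => by
  rw [coeff_expect]
  exact ha.expect_nonneg fun m => hf m x

@[simp]
theorem expect_single_one (a : ℝ[M]) : expect (fun m => (single m 1 : ℝ[M])) a = a := by
  induction a using AddMonoidAlgebra.induction_linear with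
  | zero => simp
  | add x y hx hy => simp only [map_add, hx, hy]
  | single m r => simp

theorem mapDomain_eq_expect (g : M → N) (a : ℝ[M]) :
    mapDomain g a = _root_.expect (fun m => (single (g m) 1 : ℝ[N])) a := by
  induction a using AddMonoidAlgebra.induction_linear with
  | zero => simp
  | add x y hx hy => simp [mapDomain_add, hx, hy]
  | single m r => simp

theorem NonnegMeasure.mapDomain {a : ℝ[M]} (ha : NonnegMeasure a) (g : M → N) :
    NonnegMeasure (mapDomain g a) := by
  rw [mapDomain_eq_expect]
  exact ha.expect fun m => nonnegMeasure_single _ zero_le_one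

end Expect

/-! ### The convolution algebra -/

section Convolution

variable {M V : Type*} [AddCommMonoid M] [AddCommGroup V] [Module ℝ V]

theorem expect_mul (f : M → V) (a b : ℝ[M]) :
    expect f (a * b) = expect (fun m => expect (fun m' => f (m + m')) b) a := by
  induction a using AddMonoidAlgebra.induction_linear with
  | zero => simp
  | add x y hx hy => simp [add_mul, hx, hy]
  | single m r =>
    induction b using AddMonoidAlgebra.induction_linear with
    | zero => simp
    | add x y hx hy => simp_all [mul_add]
    | single m' r' => simp [smul_smul]

theorem mul_eq_expect (a b : ℝ[M]) :
    a * b = expect (fun m => expect (fun m' => (single (m + m') 1 : ℝ[M])) b) a := by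
  rw [← expect_mul (fun m => (single m 1 : ℝ[M])), expect_single_one]

theorem NonnegMeasure.mul {a b : ℝ[M]} (ha : NonnegMeasure a) (hb : NonnegMeasure b) :
    NonnegMeasure (a * b) := by
  rw [mul_eq_expect]
  exact ha.expect fun m => hb.expect fun m' => nonnegMeasure_single _ zero_le_one

theorem nonnegMeasure_one : NonnegMeasure (1 : ℝ[M]) := nonnegMeasure_single _ zero_le_one

theorem NonnegMeasure.pow {a : ℝ[M]} (ha : NonnegMeasure a) (k : ℕ) : NonnegMeasure (a ^ k) := by
  induction k with
  | zero => simpa using nonnegMeasure_one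
  | succ k ih => rw [pow_succ]; exact ih.mul ha

theorem NonnegMeasure.prod {ι : Type*} {s : Finset ι} {a : ι → ℝ[M]}
    (ha : ∀ i ∈ s, NonnegMeasure (a i)) : NonnegMeasure (∏ i ∈ s, a i) :=
  Finset.prod_induction _ _ (fun _ _ h h' => h.mul h') nonnegMeasure_one ha

/-- The total mass of a finitely supported measure, as a character of the convolution algebra. -/
noncomputable def mass : ℝ[M] →ₐ[ℝ] ℝ :=
  AddMonoidAlgebra.lift ℝ ℝ M 1

theorem mass_eq_expect (a : ℝ[M]) : mass a = expect (fun _ => (1 : ℝ)) a := by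
  induction a using AddMonoidAlgebra.induction_linear with
  | zero => simp
  | add x y hx hy => simp [hx, hy]
  | single m r => simp [mass]

@[simp]
theorem mass_single (m : M) (r : ℝ) : mass (single m r : ℝ[M]) = r := by
  simp [mass]

theorem expect_const (c : ℝ) (a : ℝ[M]) : expect (fun _ => c) a = mass a * c := by
  rw [mass_eq_expect, mul_comm, ← smul_eq_mul, ← expect_smul_left]
  simp

/-- Multiplication of the density of a measure by the additive function `x`. It is a derivation
of the convolution algebra. -/
noncomputable def weightBy (x : M →+ ℝ) : ℝ[M] →ₗ[ℝ] ℝ[M] := expect fun m => single m (x m)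

@[simp]
theorem weightBy_single (x : M →+ ℝ) (m : M) (r : ℝ) :
    weightBy x (single m r) = single m (r * x m) := by
  simp [weightBy]

theorem weightBy_mul (x : M →+ ℝ) (a b : ℝ[M]) :
    weightBy x (a * b) = weightBy x a * b + a * weightBy x b := by
  induction a using AddMonoidAlgebra.induction_linear with
  | zero => simp
  | add a a' ha ha' => simp only [add_mul, map_add, ha, ha']; abel
  | single m r =>
    induction b using AddMonoidAlgebra.induction_linear with
    | zero => simp
    | add b b' hb hb' => simp only [mul_add, map_add, hb, hb']; abel
    | single m' r' =>
      simp only [single_mul_single, weightBy_single, map_add, ← single_add]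
      congr 1
      ring

theorem weightBy_pow_succ (x : M →+ ℝ) (a : ℝ[M]) (k : ℕ) :
    weightBy x (a ^ (k + 1)) = (k + 1 : ℝ) • (weightBy x a * a ^ k) := by
  induction k with
  | zero => simp
  | succ k ih =>
    rw [pow_succ, weightBy_mul, ih]
    push_cast
    rw [add_smul (k + 1 : ℝ) 1, one_smul, pow_succ, smul_mul_assoc, mul_comm (a ^ k * a), mul_assoc]

theorem expect_weightBy (x : M →+ ℝ) (f : M → ℝ) (a : ℝ[M]) :
    expect f (weightBy x a) = expect (fun m => x m * f m) a := by
  rw [weightBy, expect_expect]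
  simp

end Convolution

/-! ### Sums of samples that share a blanket -/

section Blanket

variable {M : Type*} [AddCommMonoid M]

/-- The signed measure `(k + 1) w B ^ k` is the law of a sum of `k + 1` samples of `B`, weighted by
the sum of the densities `X` at the samples: lift `B` to the graph of `X` in `M × ℝ`, where that sum
is an additive function and weighting by it is a derivation. A test function with values in `[0, 1]`
then picks up at most the positive part of the weight. -/
theorem expect_mul_pow_le {w B : ℝ[M]} {X : M → ℝ} (hB : NonnegMeasure B)
    (hw : w = expect (fun v => single v (X v)) B) {f : M → ℝ} (hf : ∀ m, f m ∈ Set.Icc (0 : ℝ) 1)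
    (k : ℕ) :
    (k + 1 : ℝ) * expect f (w * B ^ k) ≤
      expect (fun x => max x 0) (mapDomain X B ^ (k + 1)) := by
  set B' : ℝ[M × ℝ] := mapDomain (fun v => (v, X v)) B with hB'
  have h1 : mapDomainAlgHom ℝ ℝ (AddMonoidHom.fst M ℝ) B' = B := by
    simp only [mapDomainAlgHom_apply, hB', mapDomain_eq_expect, expect_expect]
    simp
  have h2 : mapDomainAlgHom ℝ ℝ (AddMonoidHom.snd M ℝ) B' = mapDomain X B := by
    simp only [mapDomainAlgHom_apply, hB', mapDomain_eq_expect, expect_expect]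
    simp
  have h3 : mapDomainAlgHom ℝ ℝ (AddMonoidHom.fst M ℝ) (weightBy (AddMonoidHom.snd M ℝ) B') = w := by
    simp only [mapDomainAlgHom_apply, hB', mapDomain_eq_expect, expect_expect, weightBy, hw]
    simp
  have key : (k + 1 : ℝ) • (w * B ^ k) = mapDomainAlgHom ℝ ℝ (AddMonoidHom.fst M ℝ)
      (weightBy (AddMonoidHom.snd M ℝ) (B' ^ (k + 1))) := by
    rw [weightBy_pow_succ, map_smul, map_mul, map_pow, h1, h3]
  rw [← smul_eq_mul, ← map_smul, key, ← h2, ← map_pow, mapDomainAlgHom_apply,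
    mapDomainAlgHom_apply, expect_mapDomain, expect_mapDomain, expect_weightBy]
  refine ((hB.mapDomain _).pow _).expect_mono fun m => ?_
  obtain ⟨h0, h1⟩ := hf m.1
  simp only [AddMonoidHom.coe_snd, Function.comp_apply, AddMonoidHom.coe_fst]
  rcases le_total m.2 0 with h | h
  · rw [max_eq_right h]; exact mul_nonpos_of_nonpos_of_nonneg h h0
  · rw [max_eq_left h]; exact mul_le_of_le_one_right h h1

theorem expect_mul_pow_mul_le {w B L : ℝ[M]} {X : M → ℝ} (hB : NonnegMeasure B)
    (hw : w = expect (fun v => single v (X v)) B) (hL : NonnegMeasure L)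
    {f : M → ℝ} (hf : ∀ m, f m ∈ Set.Icc (0 : ℝ) 1) (k : ℕ) :
    expect f (w * (B ^ k * L)) ≤
      mass L * ((k + 1 : ℝ)⁻¹ * expect (fun x => max x 0) (mapDomain X B ^ (k + 1))) := by
  rw [← mul_assoc, mul_comm, expect_mul, ← expect_const]
  refine hL.expect_mono fun m => ?_
  have := expect_mul_pow_le hB hw (f := fun m' => f (m + m')) (fun _ => hf _) k
  rw [inv_mul_eq_div, le_div_iff₀ (by positivity)]
  linarith

/-- The laws of the other summands are `B` plus a remainder of mass `1 - mass B`. In the expansion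
of the product, a term with `k` factors `B` is handled by `expect_mul_pow_mul_le`, and the binomial
sum of the bounds is the expansion of the right-hand side, in which the missing mass sits at `0`. -/
theorem expect_mul_prod_le {w B : ℝ[M]} {X : M → ℝ} (hB : NonnegMeasure B)
    (hw : w = expect (fun v => single v (X v)) B) {r : ℕ} {L : Fin r → ℝ[M]}
    (hL : ∀ i, NonnegMeasure (L i)) (hmass : ∀ i, mass (L i) = 1 - mass B)
    {f : M → ℝ} (hf : ∀ m, f m ∈ Set.Icc (0 : ℝ) 1) :
    (r + 1 : ℝ) * expect f (w * ∏ i, (B + L i)) ≤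
      expect (fun x => max x 0) ((mapDomain X B + single 0 (1 - mass B)) ^ (r + 1)) := by
  set Φ : ℝ[ℝ] →ₗ[ℝ] ℝ := expect (fun x => max x 0)
  set b := mapDomain X B
  set g := 1 - mass B
  have h1 : expect f (w * ∏ i, (B + L i)) ≤
      ∑ k ∈ Finset.range (r + 1), (r.choose k : ℝ) *
        (g ^ (r - k) * ((k + 1 : ℝ)⁻¹ * Φ (b ^ (k + 1)))) := by
    rw [Finset.prod_add, Finset.mul_sum, map_sum]
    simp only [Finset.prod_const]
    refine (Finset.sum_le_sum fun t _ => expect_mul_pow_mul_le hB hw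
      (NonnegMeasure.prod fun i _ => hL i) hf t.card).trans ?_
    simp only [map_prod, hmass, Finset.prod_const]
    have hcard : ∀ t : Finset (Fin r), (Finset.univ \ t).card = r - t.card := fun t => by
      rw [Finset.card_sdiff_of_subset (Finset.subset_univ t)]; simp
    simp only [hcard]
    rw [Finset.sum_powerset_apply_card (x := Finset.univ)
      (fun k => g ^ (r - k) * ((k + 1 : ℝ)⁻¹ * Φ (b ^ (k + 1))))]
    simp [g]
  have h2 : Φ ((b + single 0 g) ^ (r + 1)) = ∑ k ∈ Finset.range (r + 1),
      ((r + 1).choose (k + 1) : ℝ) * (g ^ (r - k) * Φ (b ^ (k + 1))) := by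
    have hs : ∀ j, (single 0 g : ℝ[ℝ]) ^ j = algebraMap ℝ ℝ[ℝ] (g ^ j) := fun j => by
      rw [map_pow]; rfl
    rw [add_pow, map_sum, Finset.sum_range_succ']
    simp only [hs, ← Algebra.commutes, ← Algebra.smul_def, mul_comm _ ((Nat.cast _ : ℝ[ℝ])),
      ← nsmul_eq_mul, map_smul, map_nsmul]
    have : Φ 1 = 0 := by simp [Φ, one_def]
    simp [this]
  rw [h2]
  refine (mul_le_mul_of_nonneg_left h1 (by positivity)).trans (le_of_eq ?_)
  rw [Finset.mul_sum]
  refine Finset.sum_congr rfl fun k _ => ?_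
  have h3 : ((r + 1 : ℕ) : ℝ) * (r.choose k) = ((r + 1).choose (k + 1)) * (k + 1 : ℕ) := by
    exact_mod_cast Nat.add_one_mul_choose_eq r k
  push_cast at h3
  have h4 : (k + 1 : ℝ) ≠ 0 := by positivity
  rw [← mul_assoc, h3]
  field_simp

end Blanket

/-! ### The convex order for sums -/

section ConvexOrder

/-- If translates of `φ` have smaller expectations under `c` than under `d`, the same holds for `φ`
and sums of `n` samples: replace the summands one at a time. -/
theorem expect_pow_le {φ : ℝ → ℝ} {c d : ℝ[ℝ]} (hc : NonnegMeasure c) (hd : NonnegMeasure d)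
    (h : ∀ y, expect (fun x => φ (x + y)) c ≤ expect (fun x => φ (x + y)) d) (n : ℕ) :
    expect φ (c ^ n) ≤ expect φ (d ^ n) := by
  have step : ∀ u : ℝ[ℝ], NonnegMeasure u → expect φ (u * c) ≤ expect φ (u * d) := fun u hu => by
    rw [expect_mul, expect_mul]
    exact hu.expect_mono fun m => by simpa only [add_comm m] using h m
  have : ∀ k m : ℕ, expect φ (d ^ m * c ^ k) ≤ expect φ (d ^ (m + k)) := by
    intro k
    induction k with
    | zero => simp
    | succ k ih =>
      intro m
      calc expect φ (d ^ m * c ^ (k + 1)) = expect φ ((d ^ m * c ^ k) * c) := by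
            rw [pow_succ, mul_assoc]
        _ ≤ expect φ ((d ^ m * c ^ k) * d) := step _ ((hd.pow m).mul (hc.pow k))
        _ = expect φ (d ^ (m + 1) * c ^ k) := by ring_nf
        _ ≤ expect φ (d ^ (m + (k + 1))) := by
            simpa only [add_assoc, add_comm 1 k] using ih (m + 1)
  simpa using this n 0

end ConvexOrder

/-! ### Comparison with binary randomized response -/

section TwoPoint

/-- The law of the likelihood difference of a single report of binary randomized response. -/
noncomputable def threePoint (p α β : ℝ) : ℝ[ℝ] :=
  single α p + single (-β) p + single 0 (1 - 2 * p)

theorem nonnegMeasure_threePoint {p α β : ℝ} (hp : 0 ≤ p) (hp' : 2 * p ≤ 1) :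
    NonnegMeasure (threePoint p α β) :=
  ((nonnegMeasure_single _ hp).add (nonnegMeasure_single _ hp)).add
    (nonnegMeasure_single _ (by linarith))

/-- The chord bounds of a convex function `φ` on `[-β, 0]` and `[0, α]`. -/
theorem ConvexOn.sub_le_chord {φ : ℝ → ℝ} (hφ : ConvexOn ℝ Set.univ φ) {α β x : ℝ} (hα : 0 < α)
    (hβ : 0 < β) (hx : x ≤ α) (hx' : -β ≤ x) :
    φ x - φ 0 ≤ max x 0 * ((φ α - φ 0) / α) + max (-x) 0 * ((φ (-β) - φ 0) / β) := by
  rcases le_total 0 x with h | h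
  · rw [max_eq_left h, max_eq_right (by linarith)]
    have := hφ.2 (Set.mem_univ α) (Set.mem_univ 0) (show 0 ≤ x / α by positivity)
      (show 0 ≤ 1 - x / α by rw [sub_nonneg, div_le_one hα]; exact hx) (by ring)
    simp only [smul_eq_mul, mul_zero, add_zero, div_mul_cancel₀ _ hα.ne'] at this
    have e : x * ((φ α - φ 0) / α) = x / α * (φ α - φ 0) := by ring
    rw [e]; linarith
  · rw [max_eq_right h, max_eq_left (by linarith)]
    have := hφ.2 (Set.mem_univ (-β)) (Set.mem_univ 0)
      (show 0 ≤ -x / β from div_nonneg (by linarith) hβ.le)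
      (show 0 ≤ 1 - -x / β by rw [sub_nonneg, div_le_one hβ]; linarith) (by ring)
    simp only [smul_eq_mul, mul_zero, add_zero, mul_neg, div_mul_cancel₀ _ hβ.ne', neg_neg] at this
    have e : -x * ((φ (-β) - φ 0) / β) = -x / β * (φ (-β) - φ 0) := by ring
    rw [e]; linarith

theorem ConvexOn.zero_le_add_chord {φ : ℝ → ℝ} (hφ : ConvexOn ℝ Set.univ φ) {α β : ℝ} (hα : 0 < α)
    (hβ : 0 < β) : 0 ≤ (φ α - φ 0) / α + (φ (-β) - φ 0) / β := by
  have := hφ.2 (Set.mem_univ α) (Set.mem_univ (-β))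
    (show 0 ≤ β / (α + β) by positivity) (show 0 ≤ α / (α + β) by positivity)
    (by field_simp; ring)
  have e : (β / (α + β)) • α + (α / (α + β)) • (-β) = 0 := by
    simp only [smul_eq_mul]; field_simp; ring
  rw [e, smul_eq_mul, smul_eq_mul] at this
  have h2 : 0 ≤ (α + β) / (α * β) * (β / (α + β) * φ α + α / (α + β) * φ (-β) - φ 0) :=
    mul_nonneg (by positivity) (by linarith)
  convert h2 using 1
  field_simp
  ring

variable {M : Type*}

/-- For two `ε`-close laws `a₀`, `a₁`, the law of the likelihood difference `(a₀ - e ^ t a₁) / B`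
under the blanket `B = e ^ (-ε) max(a₀, a₁)`, with the missing mass put at `0`, is below the one of
binary randomized response in the convex order. -/
theorem sum_blanket_le {S : Finset M} {a₀ a₁ B X : M → ℝ} {E T : ℝ} (hT : 1 ≤ T) (hTE : T < E)
    (h₀ : ∀ v, 0 ≤ a₀ v) (h₁ : ∀ v, 0 ≤ a₁ v) (h₀₁ : ∀ v, a₀ v ≤ E * a₁ v)
    (h₁₀ : ∀ v, a₁ v ≤ E * a₀ v) (hs₀ : ∑ v ∈ S, a₀ v = 1) (hs₁ : ∑ v ∈ S, a₁ v = 1)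
    (hB : ∀ v, B v = E⁻¹ * max (a₀ v) (a₁ v)) (hX : ∀ v, X v = (a₀ v - T * a₁ v) / B v)
    {φ : ℝ → ℝ} (hφ : ConvexOn ℝ Set.univ φ) :
    ∑ v ∈ S, B v * φ (X v) + (1 - ∑ v ∈ S, B v) * φ 0 ≤
      expect φ (threePoint (E + 1)⁻¹ (E - T) (T * E - 1)) := by
  have hE : 0 < E := by linarith
  set α := E - T with hα'
  set β := T * E - 1 with hβ'
  have hα : 0 < α := by linarith
  have hβ : 0 < β := by nlinarith
  set A := (φ α - φ 0) / α with hA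
  set N := (φ (-β) - φ 0) / β with hN
  have hAN : 0 ≤ A + N := hφ.zero_le_add_chord hα hβ
  have hB0 : ∀ v, 0 ≤ B v := fun v => by
    rw [hB]; exact mul_nonneg (by positivity) (le_max_of_le_left (h₀ v))
  have hw : ∀ v, max (a₀ v - T * a₁ v) 0 ≤ α / (E ^ 2 - 1) * (E * a₀ v - a₁ v) := fun v => by
    have hE2 : 0 < E ^ 2 - 1 := by nlinarith
    rw [div_mul_eq_mul_div, le_div_iff₀ hE2]
    rcases le_total (a₀ v - T * a₁ v) 0 with h | h
    · rw [max_eq_right h, zero_mul]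
      exact mul_nonneg hα.le (by linarith [h₁₀ v])
    · rw [max_eq_left h]
      have : 0 ≤ β * (E * a₁ v - a₀ v) := mul_nonneg hβ.le (by linarith [h₀₁ v])
      simp only [hα', hβ'] at *
      linarith
  have hpt : ∀ v, B v * (φ (X v) - φ 0) ≤
      α / (E ^ 2 - 1) * (E * a₀ v - a₁ v) * (A + N) - (a₀ v - T * a₁ v) * N := fun v => by
    have h2 : B v * (φ (X v) - φ 0) ≤
        max (a₀ v - T * a₁ v) 0 * (A + N) - (a₀ v - T * a₁ v) * N := by
      rcases (hB0 v).eq_or_lt with h | h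
      · have hm : max (a₀ v) (a₁ v) = 0 := by
          have := hB v
          rw [← h] at this
          exact (mul_eq_zero.1 this.symm).resolve_left (by positivity)
        have e0 : a₀ v = 0 := le_antisymm (hm ▸ le_max_left _ _) (h₀ v)
        have e1 : a₁ v = 0 := le_antisymm (hm ▸ le_max_right _ _) (h₁ v)
        simp [← h, e0, e1]
      · have hBE : max (a₀ v) (a₁ v) = E * B v := by rw [hB]; field_simp
        have l0 : a₀ v ≤ E * B v := hBE ▸ le_max_left _ _
        have l1 : a₁ v ≤ E * B v := hBE ▸ le_max_right _ _
        -- both laws are at least `B`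
        have g0 : B v ≤ a₀ v := by
          have : E * B v ≤ E * a₀ v := by
            rw [← hBE]; exact max_le (by nlinarith [h₀ v]) (h₁₀ v)
          exact le_of_mul_le_mul_left this hE
        have g1 : B v ≤ a₁ v := by
          have : E * B v ≤ E * a₁ v := by
            rw [← hBE]; exact max_le (h₀₁ v) (by nlinarith [h₁ v])
          exact le_of_mul_le_mul_left this hE
        have x1 : X v ≤ α := by
          rw [hX, div_le_iff₀ h]
          nlinarith
        have x2 : -β ≤ X v := by
          rw [hX, le_div_iff₀ h]
          nlinarith
        have := mul_le_mul_of_nonneg_left (hφ.sub_le_chord hα hβ x1 x2) h.le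
        refine this.trans (le_of_eq ?_)
        have e1 : B v * max (X v) 0 = max (a₀ v - T * a₁ v) 0 := by
          rw [mul_max_of_nonneg _ _ h.le, hX, mul_div_cancel₀ _ h.ne', mul_zero]
        have e2 : B v * max (-X v) 0 = max (a₀ v - T * a₁ v) 0 - (a₀ v - T * a₁ v) := by
          rw [mul_max_of_nonneg _ _ h.le, hX, mul_neg, mul_div_cancel₀ _ h.ne', mul_zero]
          rcases le_total (a₀ v - T * a₁ v) 0 with h | h
          · rw [max_eq_right h, max_eq_left (by linarith)]; ring
          · rw [max_eq_left h, max_eq_right (by linarith)]; ring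
        rw [mul_add, ← mul_assoc, ← mul_assoc, e1, e2]
        ring
    refine h2.trans ?_
    have := mul_le_mul_of_nonneg_right (hw v) hAN
    linarith
  have hsum := Finset.sum_le_sum fun v (_ : v ∈ S) => hpt v
  have e3 : ∑ v ∈ S, B v * (φ (X v) - φ 0) = ∑ v ∈ S, B v * φ (X v) - (∑ v ∈ S, B v) * φ 0 := by
    simp only [mul_sub, Finset.sum_sub_distrib, Finset.sum_mul]
  have e4 : ∑ v ∈ S, (α / (E ^ 2 - 1) * (E * a₀ v - a₁ v) * (A + N) - (a₀ v - T * a₁ v) * N) =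
      α / (E ^ 2 - 1) * (E - 1) * (A + N) - (1 - T) * N := by
    rw [Finset.sum_sub_distrib, ← Finset.sum_mul, ← Finset.sum_mul, ← Finset.mul_sum,
      Finset.sum_sub_distrib, Finset.sum_sub_distrib, ← Finset.mul_sum, ← Finset.mul_sum, hs₀, hs₁]
    ring
  rw [e3, e4] at hsum
  have e5 : expect φ (threePoint (E + 1)⁻¹ α β) =
      φ 0 + (E + 1)⁻¹ * (α * A) + (E + 1)⁻¹ * (β * N) := by
    simp only [threePoint, map_add, expect_single, smul_eq_mul, hA, hN,
      mul_div_cancel₀ _ hα.ne', mul_div_cancel₀ _ hβ.ne']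
    ring
  have e6 : α / (E ^ 2 - 1) * (E - 1) * (A + N) - (1 - T) * N =
      (E + 1)⁻¹ * (α * A) + (E + 1)⁻¹ * (β * N) := by
    have : E ^ 2 - 1 = (E - 1) * (E + 1) := by ring
    have h1 : E - 1 ≠ 0 := by linarith
    rw [this, hα', hβ']
    field_simp
    ring
  rw [e5]
  linarith

end TwoPoint

/-! ### The amplification bound for signed measures -/

section Shuffle

theorem convexOn_max_add (y : ℝ) : ConvexOn ℝ Set.univ fun x : ℝ => max (x + y) 0 :=
  ((convexOn_id convex_univ).add_const y).sup (convexOn_const 0 convex_univ)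

theorem eq_sum_single {M : Type*} (a : ℝ[M]) {S : Finset M} (hS : a.coeff.support ⊆ S) :
    a = ∑ v ∈ S, single v (a.coeff v) := by
  conv_lhs => rw [← expect_single_one a, expect_eq_sum]
  simp only [smul_single, smul_eq_mul, mul_one]
  refine Finset.sum_subset hS fun v _ hv => ?_
  simp [Finsupp.notMem_support_iff.1 hv]

/-- Privacy amplification by shuffling: the sum of `r + 1` reports, one of which has the law `a₀`
or `a₁` while all laws involved are `ε`-close, is at most as distinguishable as the shuffled
reports of binary randomized response. -/
theorem shuffle_bound {M : Type*} [AddCommMonoid M] {E T : ℝ} (hT : 1 ≤ T) (hTE : T < E)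
    {a₀ a₁ : ℝ[M]} {r : ℕ} {ν : Fin r → ℝ[M]}
    (h₀ : NonnegMeasure a₀) (h₁ : NonnegMeasure a₁) (hm₀ : mass a₀ = 1) (hm₁ : mass a₁ = 1)
    (hmν : ∀ i, mass (ν i) = 1)
    (h₀₁ : ∀ v, a₀.coeff v ≤ E * a₁.coeff v) (h₁₀ : ∀ v, a₁.coeff v ≤ E * a₀.coeff v)
    (h₀ν : ∀ i v, a₀.coeff v ≤ E * (ν i).coeff v) (h₁ν : ∀ i v, a₁.coeff v ≤ E * (ν i).coeff v)
    {f : M → ℝ} (hf : ∀ m, f m ∈ Set.Icc (0 : ℝ) 1) :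
    (r + 1 : ℝ) * expect f ((a₀ - T • a₁) * ∏ i, ν i) ≤
      expect (fun x => max x 0) (threePoint (E + 1)⁻¹ (E - T) (T * E - 1) ^ (r + 1)) := by
  classical
  have hE : 0 < E := by linarith
  set S := a₀.coeff.support ∪ a₁.coeff.support with hS
  set β : M → ℝ := fun v => E⁻¹ * max (a₀.coeff v) (a₁.coeff v) with hβ
  have hβ0 : ∀ v, 0 ≤ β v := fun v =>
    mul_nonneg (by positivity) (le_max_of_le_left (h₀ v))
  set X : M → ℝ := fun v => (a₀.coeff v - T * a₁.coeff v) / β v with hX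
  set B : ℝ[M] := ∑ v ∈ S, single v (β v) with hB
  have e₀ : a₀ = ∑ v ∈ S, single v (a₀.coeff v) := eq_sum_single _ Finset.subset_union_left
  have e₁ : a₁ = ∑ v ∈ S, single v (a₁.coeff v) := eq_sum_single _ Finset.subset_union_right
  have hBn : NonnegMeasure B := NonnegMeasure.sum fun v _ => nonnegMeasure_single _ (hβ0 v)
  have hβS : ∀ v, v ∉ S → β v = 0 := fun v hv => by
    simp only [hS, Finset.mem_union, not_or, Finsupp.notMem_support_iff] at hv
    simp [hβ, hv.1, hv.2]
  have hBc : ∀ v, B.coeff v = β v := fun v => by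
    simp only [hB, coeff_sum, coeff_single, Finsupp.finsetSum_apply, Finsupp.single_apply,
      Finset.sum_ite_eq']
    split_ifs with h
    · rfl
    · exact (hβS v h).symm
  have hw : a₀ - T • a₁ = expect (fun v => single v (X v)) B := by
    simp only [hB, map_sum, expect_single, smul_single, smul_eq_mul]
    conv_lhs => rw [e₀, e₁]
    rw [Finset.smul_sum, ← Finset.sum_sub_distrib]
    refine Finset.sum_congr rfl fun v _ => ?_
    rw [smul_single, smul_eq_mul, ← single_sub]
    congr 1
    rcases (hβ0 v).eq_or_lt with h | h
    · have hm : max (a₀.coeff v) (a₁.coeff v) = 0 :=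
        (mul_eq_zero.1 h.symm).resolve_left (by positivity)
      have e0 : a₀.coeff v = 0 := le_antisymm (hm ▸ le_max_left _ _) (h₀ v)
      have e1 : a₁.coeff v = 0 := le_antisymm (hm ▸ le_max_right _ _) (h₁ v)
      simp [← h, e0, e1]
    · rw [hX, mul_div_cancel₀ _ h.ne']
  have hs₀ : ∑ v ∈ S, a₀.coeff v = 1 := by rw [← hm₀]; conv_rhs => rw [e₀, map_sum]; simp
  have hs₁ : ∑ v ∈ S, a₁.coeff v = 1 := by rw [← hm₁]; conv_rhs => rw [e₁, map_sum]; simp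
  have hmB : mass B = ∑ v ∈ S, β v := by simp [hB]
  have hβ₀ : ∀ v, β v ≤ a₀.coeff v := fun v => by
    rw [hβ, inv_mul_le_iff₀ hE]
    exact max_le (by nlinarith [h₀ v]) (h₁₀ v)
  have hmB1 : mass B ≤ 1 := by
    rw [hmB, ← hs₀]; exact Finset.sum_le_sum fun v _ => hβ₀ v
  have hL : ∀ i, NonnegMeasure (ν i - B) := fun i v => by
    simp only [coeff_sub, Finsupp.sub_apply, hBc, sub_nonneg, hβ, inv_mul_le_iff₀ hE]
    exact max_le (h₀ν i v) (h₁ν i v)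
  have key := expect_mul_prod_le hBn hw hL (fun i => by rw [map_sub, hmν]) hf
  simp only [add_sub_cancel] at key
  refine key.trans (expect_pow_le (φ := fun x => max x 0) ?_ ?_ (fun y => ?_) _)
  · exact (hBn.mapDomain _).add (nonnegMeasure_single _ (by linarith))
  · refine nonnegMeasure_threePoint (by positivity) ?_
    rw [← div_eq_mul_inv, div_le_one (by linarith)]
    linarith
  · refine le_trans (le_of_eq ?_) (sum_blanket_le (S := S) (B := β) (X := X) hT hTE h₀ h₁ h₀₁ h₁₀
      hs₀ hs₁ (fun _ => rfl) (fun _ => rfl) (convexOn_max_add y))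
    rw [map_add, expect_mapDomain, hmB]
    simp only [hB, map_sum, expect_single, Function.comp_apply, smul_eq_mul]

end Shuffle

/-! ### Probability laws as elements of the convolution algebra -/

section Represents

variable {M N : Type*}

/-- The finitely supported measure `a` is the law `p`. -/
def Represents (p : PMF M) (a : ℝ[M]) : Prop := ∀ m, (p m).toReal = a.coeff m

theorem exists_represents {p : PMF M} (hp : p.support.Finite) : ∃ a, Represents p a := by
  refine ⟨.ofCoeff (Finsupp.ofSupportFinite (fun m => (p m).toReal) (hp.subset fun m hm => ?_)),
    fun m => rfl⟩
  rw [PMF.mem_support_iff]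
  intro h
  simp [h] at hm

theorem Represents.nonneg {p : PMF M} {a : ℝ[M]} (h : Represents p a) : NonnegMeasure a :=
  fun m => h m ▸ ENNReal.toReal_nonneg

theorem Represents.apply_eq {p : PMF M} {a : ℝ[M]} (h : Represents p a) (m : M) :
    p m = ENNReal.ofReal (a.coeff m) := by
  rw [← h m, ENNReal.ofReal_toReal (p.apply_ne_top m)]

theorem Represents.tsum_mul {p : PMF M} {a : ℝ[M]} (h : Represents p a) (g : M → ENNReal) :
    ∑' m, p m * g m = ∑ m ∈ a.coeff.support, p m * g m := by
  refine tsum_eq_sum fun m hm => ?_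
  rw [h.apply_eq, Finsupp.notMem_support_iff.1 hm]
  simp

theorem Represents.toOuterMeasure_apply {p : PMF M} {a : ℝ[M]} (h : Represents p a) (O : Set M) :
    p.toOuterMeasure O = ENNReal.ofReal (expect (O.indicator fun _ => (1 : ℝ)) a) := by
  classical
  have : p.toOuterMeasure O = ∑' m, p m * O.indicator (fun _ => 1) m := by
    rw [PMF.toOuterMeasure_apply]
    congr 1
    ext m
    by_cases hm : m ∈ O <;> simp [hm]
  rw [this, h.tsum_mul, expect_eq_sum, ENNReal.ofReal_sum_of_nonneg]
  · refine Finset.sum_congr rfl fun m _ => ?_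
    rw [h.apply_eq]
    by_cases hm : m ∈ O <;> simp [hm]
  · intro m _
    refine mul_nonneg (h.nonneg m) (Set.indicator_nonneg (fun _ _ => zero_le_one) _)

theorem Represents.bind {p : PMF M} {a : ℝ[M]} (h : Represents p a) {g : M → PMF N}
    {b : M → ℝ[N]} (hg : ∀ m, Represents (g m) (b m)) :
    Represents (p.bind g) (expect b a) := fun x => by
  rw [PMF.bind_apply, h.tsum_mul, ENNReal.toReal_sum, coeff_expect, expect_eq_sum]
  · refine Finset.sum_congr rfl fun m _ => ?_
    rw [ENNReal.toReal_mul, h m, hg m x, smul_eq_mul]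
  · exact fun m _ => ENNReal.mul_ne_top (p.apply_ne_top m) ((g m).apply_ne_top x)

theorem represents_pure (m : M) : Represents (PMF.pure m) (single m 1) := fun x => by
  classical
  rw [PMF.pure_apply, coeff_single, Finsupp.single_apply]
  simp only [eq_comm (a := x)]
  split_ifs <;> simp

theorem Represents.map {p : PMF M} {a : ℝ[M]} (h : Represents p a) (f : M → N) :
    Represents (p.map f) (mapDomain f a) := by
  rw [mapDomain_eq_expect]
  exact h.bind fun m => represents_pure (f m)

theorem Represents.mass [AddCommMonoid M] {p : PMF M} {a : ℝ[M]} (h : Represents p a) :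
    mass a = 1 := by
  have h1 := h.toOuterMeasure_apply Set.univ
  rw [(PMF.toOuterMeasure_apply_eq_one_iff p Set.univ).2 (Set.subset_univ _), Set.indicator_univ,
    ← mass_eq_expect, eq_comm, ENNReal.ofReal_eq_one] at h1
  exact h1

theorem Represents.convolution [AddCommMonoid M] {p q : PMF M} {a b : ℝ[M]} (hp : Represents p a)
    (hq : Represents q b) :
    Represents (p.bind fun x => q.map fun y => x + y) (a * b) := by
  have := hp.bind fun m => hq.map fun y => m + y
  simpa only [mapDomain_eq_expect, ← mul_eq_expect] using this

theorem represents_indepSum [AddCommMonoid M] {ι : Type*} {l : List ι} {p : ι → PMF M}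
    {a : ι → ℝ[M]} (h : ∀ i ∈ l, Represents (p i) (a i)) :
    Represents (indepSum (l.map p)) (l.map a).prod := by
  induction l with
  | nil => exact represents_pure 0
  | cons i l ih =>
    rw [List.map_cons, List.map_cons, List.prod_cons]
    exact (h i (by simp)).convolution (ih fun j hj => h j (by simp [hj]))

theorem dominatedBy_iff {t δ : ℝ} (hδ : 0 ≤ δ) {p q : PMF M} {a b : ℝ[M]} (hp : Represents p a)
    (hq : Represents q b) :
    DominatedBy t δ p q ↔
      ∀ O : Set M, expect (O.indicator fun _ => (1 : ℝ)) (a - Real.exp t • b) ≤ δ := by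
  refine forall_congr' fun O => ?_
  have h0 : 0 ≤ expect (O.indicator fun _ => (1 : ℝ)) b :=
    hq.nonneg.expect_nonneg fun m => Set.indicator_nonneg (fun _ _ => zero_le_one) _
  rw [hp.toOuterMeasure_apply, hq.toOuterMeasure_apply, ← ENNReal.ofReal_mul (Real.exp_pos t).le,
    ← ENNReal.ofReal_add (mul_nonneg (Real.exp_pos t).le h0) hδ,
    ENNReal.ofReal_le_ofReal_iff (add_nonneg (mul_nonneg (Real.exp_pos t).le h0) hδ), map_sub,
    map_smul, smul_eq_mul, sub_le_iff_le_add']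

theorem represents_coin_map {p : ℝ} (h0 : 0 ≤ p) (h1 : p ≤ 1) (f : Bool → M) :
    Represents ((coin p).map f) (single (f true) p + single (f false) (1 - p)) := by
  have hc : Represents (coin p) (single true p + single false (1 - p)) := by
    intro b
    have hp : min (ENNReal.ofReal p) 1 = ENNReal.ofReal p :=
      min_eq_left (ENNReal.ofReal_le_one.2 h1)
    cases b
    · simp only [coin, hp, PMF.ofFintype_apply, Bool.false_eq_true, if_false]
      rw [← ENNReal.ofReal_one, ← ENNReal.ofReal_sub _ h0, ENNReal.toReal_ofReal (by linarith)]
      simp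
    · simp only [coin, hp, PMF.ofFintype_apply, if_true]
      rw [ENNReal.toReal_ofReal h0]
      simp
  simpa [mapDomain_add, -single_sub] using hc.map f

end Represents

/-! ### The pair of counts of binary randomized response -/

section ShufflePair

theorem represents_binomialLaw (m : ℕ) {p : ℝ} (h0 : 0 ≤ p) (h1 : p ≤ 1) :
    Represents (binomialLaw m p) ((single 1 p + single 0 (1 - p)) ^ m) := by
  have := represents_indepSum (l := List.replicate m ()) (M := ℕ)
    (p := fun _ => (coin p).map fun b => if b then 1 else 0)
    (a := fun _ => single 1 p + single 0 (1 - p))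
    fun _ _ => represents_coin_map h0 h1 fun b => if b then 1 else 0
  simpa [binomialLaw] using this

/-- The expectation under the binomial law, for weights `q` and `q'` of success and failure that
need not add up to `1`. -/
theorem expect_binomial {V : Type*} [AddCommGroup V] [Module ℝ V] (m : ℕ) (q q' : ℝ) (g : ℕ → V) :
    expect g ((single 1 q + single 0 q' : ℝ[ℕ]) ^ m) =
      ∑ k ∈ Finset.range (m + 1), (q ^ k * q' ^ (m - k) * m.choose k) • g k := by
  rw [add_pow, map_sum]
  refine Finset.sum_congr rfl fun k _ => ?_
  rw [single_pow, single_pow, single_mul_single, mul_comm, ← nsmul_eq_mul, map_nsmul]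
  simp only [smul_eq_mul, mul_one, expect_single]
  rw [← Nat.cast_smul_eq_nsmul ℝ, smul_smul]
  congr 1
  ring

theorem add_pow_eq_expect {A : Type*} [CommRing A] [Algebra ℝ A] (m : ℕ) (q q' : ℝ) (x y : A) :
    (q • x + q' • y) ^ m =
      expect (fun k => x ^ k * y ^ (m - k)) ((single 1 q + single 0 q' : ℝ[ℕ]) ^ m) := by
  rw [expect_binomial, add_pow]
  refine Finset.sum_congr rfl fun k _ => ?_
  simp only [smul_pow, smul_mul_smul_comm, mul_smul, ← Nat.cast_smul_eq_nsmul ℝ,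
    mul_comm _ (Nat.cast _ : A), ← nsmul_eq_mul]
  simp only [smul_smul]
  congr 1
  ring

/-- The law of the contribution of one of the other users to the pair of counts, with
`p = 1 / (e ^ ε + 1)`. -/
noncomputable def clone (p : ℝ) : ℝ[ℕ × ℕ] :=
  single (1, 0) p + single (0, 1) p + single 0 (1 - 2 * p)

theorem nonnegMeasure_clone {p : ℝ} (hp : 0 ≤ p) (hp' : 2 * p ≤ 1) : NonnegMeasure (clone p) :=
  ((nonnegMeasure_single _ hp).add (nonnegMeasure_single _ hp)).add
    (nonnegMeasure_single _ (by linarith))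

theorem represents_shufflePair₀ {ε : ℝ} (hε : 0 ≤ ε) (n : ℕ) :
    Represents (shufflePair₀ ε n)
      ((single (1, 0) (Real.exp ε * (Real.exp ε + 1)⁻¹) + single (0, 1) (Real.exp ε + 1)⁻¹) *
        clone (Real.exp ε + 1)⁻¹ ^ (n - 1)) := by
  have hE : 1 ≤ Real.exp ε := Real.one_le_exp hε
  set p := (Real.exp ε + 1)⁻¹ with hp
  set d : ℝ[ℕ × ℕ] := single (1, 0) (Real.exp ε * p) + single (0, 1) p with hd
  set h : ℝ[ℕ × ℕ] := single (1, 0) (1 / 2) + single (0, 1) (1 - 1 / 2) with hh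
  have hd' : (1 - Real.exp ε / (Real.exp ε + 1)) = p := by rw [hp]; field_simp; ring
  have hinner : ∀ C, Represents ((binomialLaw C (1 / 2)).bind fun A =>
      (coin (Real.exp ε / (Real.exp ε + 1))).map fun Δ =>
        if Δ then (A + 1, C - A) else (A, C - A + 1)) (d * h ^ C) := fun C => by
    have h1 := (represents_binomialLaw C (p := 1 / 2) (by norm_num) (by norm_num)).bind fun A =>
      represents_coin_map (p := Real.exp ε / (Real.exp ε + 1)) (by positivity)
        (by rw [div_le_one (by positivity)]; linarith)
        fun Δ => if Δ then (A + 1, C - A) else (A, C - A + 1)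
    convert h1 using 1
    have h2 : h = (1 / 2 : ℝ) • single (1, 0) 1 + (1 - 1 / 2 : ℝ) • single (0, 1) 1 := by
      simp [hh]
    rw [h2, add_pow_eq_expect, expect_eq_sum, expect_eq_sum, Finset.mul_sum]
    refine Finset.sum_congr rfl fun A _ => ?_
    rw [mul_smul_comm]
    congr 1
    rw [hd']
    simp [hd, single_pow, add_mul, add_comm, div_eq_mul_inv, hp]
  have h3 := (represents_binomialLaw (n - 1) (p := 2 / (Real.exp ε + 1)) (by positivity)
    (by rw [div_le_one (by positivity)]; linarith)).bind hinner
  have h4 : clone p = (2 / (Real.exp ε + 1)) • h + (1 - 2 / (Real.exp ε + 1)) • 1 := by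
    simp only [clone, hh, one_def, smul_add, smul_single, smul_eq_mul]
    have e1 : 2 / (Real.exp ε + 1) * (1 / 2) = p := by rw [hp]; ring
    have e2 : 2 / (Real.exp ε + 1) * (1 - 1 / 2) = p := by rw [hp]; ring
    have e3 : (1 - 2 / (Real.exp ε + 1)) * 1 = 1 - 2 * p := by rw [hp]; ring
    rw [e1, e2, e3]
  suffices h5 : d * clone p ^ (n - 1) = expect (fun C => d * h ^ C)
      ((single 1 (2 / (Real.exp ε + 1)) + single 0 (1 - 2 / (Real.exp ε + 1))) ^ (n - 1)) by
    rw [h5]; exact h3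
  rw [h4, add_pow_eq_expect, expect_eq_sum, expect_eq_sum, Finset.mul_sum]
  exact Finset.sum_congr rfl fun C _ => by simp

theorem represents_shufflePair₁ {ε : ℝ} (hε : 0 ≤ ε) (n : ℕ) :
    Represents (shufflePair₁ ε n)
      ((single (1, 0) (Real.exp ε + 1)⁻¹ + single (0, 1) (Real.exp ε * (Real.exp ε + 1)⁻¹)) *
        clone (Real.exp ε + 1)⁻¹ ^ (n - 1)) := by
  have h := (represents_shufflePair₀ hε n).map Prod.swap
  have : ∀ a, mapDomain Prod.swap a =
      mapDomainAlgHom ℝ ℝ (AddEquiv.prodComm : ℕ × ℕ ≃+ ℕ × ℕ).toAddMonoidHom a := fun a => rfl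
  rw [this, map_mul, map_pow] at h
  simp only [clone, map_add, mapDomainAlgHom_apply, mapDomain_single] at h
  simpa [shufflePair₁, clone, add_comm, -single_sub] using h

/-- The linear combination `(a, b) ↦ x a + y b` of the two counts. -/
noncomputable def countForm (x y : ℝ) : ℕ × ℕ →+ ℝ :=
  AddMonoidHom.coprod ((AddMonoidHom.mulLeft x).comp (Nat.castAddMonoidHom ℝ))
    ((AddMonoidHom.mulLeft y).comp (Nat.castAddMonoidHom ℝ))

@[simp]
theorem countForm_apply (x y : ℝ) (m : ℕ × ℕ) : countForm x y m = x * m.1 + y * m.2 := rfl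

/-- Both laws `Q` of the pair of counts have a density, linear in the counts, with respect to the
law of the counts of `n` clones. -/
theorem weightBy_clone_pow (x y p : ℝ) (r : ℕ) :
    weightBy (countForm x y) (clone p ^ (r + 1)) =
      (r + 1 : ℝ) • ((single (1, 0) (x * p) + single (0, 1) (y * p)) * clone p ^ r) := by
  rw [weightBy_pow_succ]
  congr 2
  simp [clone, mul_comm]

/-- The linear form `(a, b) ↦ α a - β b` carries the law of the counts of clones to the three-point
law. The event on which it is positive is the one that, for suitable `α` and `β`, best
distinguishes the two laws of the pair of counts. -/
theorem expect_threePoint_pow (p α β : ℝ) (r : ℕ) :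
    expect (fun x => max x 0) (threePoint p α β ^ (r + 1)) =
      (r + 1 : ℝ) * expect ({m : ℕ × ℕ | 0 < countForm α (-β) m}.indicator fun _ => (1 : ℝ))
        ((single (1, 0) (α * p) + single (0, 1) (-β * p)) * clone p ^ r) := by
  have h1 : mapDomainAlgHom ℝ ℝ (countForm α (-β)) (clone p) = threePoint p α β := by
    simp only [clone, map_add, mapDomainAlgHom_apply, mapDomain_single]
    simp [threePoint]
  rw [← smul_eq_mul, ← map_smul, ← weightBy_clone_pow, expect_weightBy, ← h1, ← map_pow,
    mapDomainAlgHom_apply, expect_mapDomain]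
  congr 2
  ext m
  by_cases h : 0 < countForm α (-β) m
  · simp only [Function.comp_apply, Set.indicator, Set.mem_ofPred_eq, h, if_true, mul_one]
    exact max_eq_left h.le
  · simp only [Function.comp_apply, Set.indicator, Set.mem_ofPred_eq, h, if_false, mul_zero]
    exact max_eq_right (not_lt.1 h)

end ShufflePair

/-! ### Privacy amplification by shuffling -/

section Amplification

/-- `p ≤ e ^ ε q` pointwise. -/
def PointwiseClose {M : Type*} (ε : ℝ) (p q : PMF M) : Prop :=
  ∀ m, p m ≤ ENNReal.ofReal (Real.exp ε) * q m

theorem PointwiseClose.coeff_le {M : Type*} {ε : ℝ} {p q : PMF M} (h : PointwiseClose ε p q)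
    {a b : ℝ[M]} (hp : Represents p a) (hq : Represents q b) (m : M) :
    a.coeff m ≤ Real.exp ε * b.coeff m := by
  have := h m
  rwa [hp.apply_eq, hq.apply_eq, ← ENNReal.ofReal_mul (Real.exp_pos ε).le,
    ENNReal.ofReal_le_ofReal_iff (mul_nonneg (Real.exp_pos ε).le (hq.nonneg m))] at this

/-- For `t ≥ ε` the claim follows from closeness alone; for `t < ε` it is `shuffle_bound`, evaluated
for the laws of the pair of counts. -/
theorem dominatedBy_of_shufflePair {M : Type*} [AddCommMonoid M] {ε t δ : ℝ} (hε : 0 ≤ ε)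
    (ht : 0 ≤ t) (hδ : 0 ≤ δ) {p₀ p₁ : PMF M} {l : List (PMF M)}
    (hf₀ : p₀.support.Finite) (hf₁ : p₁.support.Finite) (hf : ∀ q ∈ l, q.support.Finite)
    (h₀₁ : PointwiseClose ε p₀ p₁) (h₁₀ : PointwiseClose ε p₁ p₀)
    (h₀ : ∀ q ∈ l, PointwiseClose ε p₀ q) (h₁ : ∀ q ∈ l, PointwiseClose ε p₁ q)
    (hd : DominatedBy t δ (shufflePair₀ ε (l.length + 1)) (shufflePair₁ ε (l.length + 1))) :
    DominatedBy t δ (indepSum (p₀ :: l)) (indepSum (p₁ :: l)) := by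
  classical
  obtain ⟨a₀, ha₀⟩ := exists_represents hf₀
  obtain ⟨a₁, ha₁⟩ := exists_represents hf₁
  have : ∀ q : PMF M, ∃ a : ℝ[M], q ∈ l → Represents q a := fun q => by
    by_cases hq : q ∈ l
    · obtain ⟨a, ha⟩ := exists_represents (hf q hq)
      exact ⟨a, fun _ => ha⟩
    · exact ⟨0, fun h => absurd h hq⟩
  choose a ha using this
  have hl := represents_indepSum ha
  rw [List.map_id'] at hl
  refine (dominatedBy_iff hδ (ha₀.convolution hl) (ha₁.convolution hl)).2 fun O => ?_
  have hO : ∀ m, O.indicator (fun _ => (1 : ℝ)) m ∈ Set.Icc (0 : ℝ) 1 := fun m => by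
    by_cases h : m ∈ O <;> simp [h]
  rw [← smul_mul_assoc, ← sub_mul]
  rcases lt_or_ge t ε with hlt | hge
  · have hprod : (l.map a).prod = ∏ i : Fin l.length, a (l.get i) := by
      rw [← List.prod_ofFn]
      congr 1
      apply List.ext_getElem <;> simp
    rw [hprod]
    have hp : (0 : ℝ) < Real.exp ε + 1 := by positivity
    have key := shuffle_bound (Real.one_le_exp ht) (Real.exp_lt_exp.2 hlt) ha₀.nonneg ha₁.nonneg
      ha₀.mass ha₁.mass (ν := fun i : Fin l.length => a (l.get i))
      (fun i => (ha _ (List.getElem_mem _)).mass) (h₀₁.coeff_le ha₀ ha₁) (h₁₀.coeff_le ha₁ ha₀)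
      (fun i => (h₀ _ (l.get_mem i)).coeff_le ha₀ (ha _ (l.get_mem i)))
      (fun i => (h₁ _ (l.get_mem i)).coeff_le ha₁ (ha _ (l.get_mem i))) hO
    rw [expect_threePoint_pow] at key
    rw [dominatedBy_iff hδ (represents_shufflePair₀ hε _) (represents_shufflePair₁ hε _)] at hd
    refine (le_of_mul_le_mul_left key (by positivity)).trans (le_trans (le_of_eq ?_)
      (hd {m : ℕ × ℕ | 0 < countForm (Real.exp ε - Real.exp t)
        (-(Real.exp t * Real.exp ε - 1)) m}))
    congr 1
    rw [Nat.add_sub_cancel, ← smul_mul_assoc, ← sub_mul, smul_add, add_sub_add_comm]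
    simp only [smul_single, ← single_sub, smul_eq_mul]
    congr 3 <;> ring
  · refine le_trans ?_ hδ
    have hn : NonnegMeasure (Real.exp t • a₁ - a₀) := fun m => by
      have h := h₀₁.coeff_le ha₀ ha₁ m
      have h' := mul_le_mul_of_nonneg_right (Real.exp_le_exp.2 hge) (ha₁.nonneg m)
      simp only [coeff_sub, coeff_smul, Finsupp.sub_apply, Finsupp.smul_apply, smul_eq_mul]
      linarith
    have := (hn.mul hl.nonneg).expect_nonneg fun m => (hO m).1
    rw [← neg_sub, neg_mul, map_neg]
    linarith

end Amplification

/-! ### The numerical privacy parameter -/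

section ShuffleEps

theorem dominatedBy_of_nonnegMeasure {M : Type*} {t δ : ℝ} (hδ : 0 ≤ δ) {p q : PMF M} {a b : ℝ[M]}
    (hp : Represents p a) (hq : Represents q b) (h : NonnegMeasure (Real.exp t • b - a)) :
    DominatedBy t δ p q := by
  refine (dominatedBy_iff hδ hp hq).2 fun O => le_trans ?_ hδ
  have := h.expect_nonneg (f := O.indicator fun _ => (1 : ℝ))
    (Set.indicator_nonneg fun _ _ => zero_le_one)
  rw [← neg_sub, map_neg]
  linarith

theorem DominatedBy.map {M N : Type*} {t δ : ℝ} {p q : PMF M} (h : DominatedBy t δ p q)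
    (f : M → N) : DominatedBy t δ (p.map f) (q.map f) := fun O => by
  simpa only [PMF.toOuterMeasure_map_apply] using h (f ⁻¹' O)

/-- The second law is the first one with the counts exchanged, so one of the two inequalities
suffices. -/
theorem dominatedBy_shufflePair_swap {ε t δ : ℝ} {n : ℕ}
    (h : DominatedBy t δ (shufflePair₀ ε n) (shufflePair₁ ε n)) :
    DominatedBy t δ (shufflePair₁ ε n) (shufflePair₀ ε n) := by
  have := h.map Prod.swap
  rwa [shufflePair₁, PMF.map_comp, Prod.swap_swap_eq, PMF.map_id] at this

/-- The level `ε` is attained without amplification, by closeness of the two randomized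
responses. -/
theorem dominatedBy_shufflePair_self {ε δ : ℝ} (hε : 0 ≤ ε) (hδ : 0 ≤ δ) (n : ℕ) :
    DominatedBy ε δ (shufflePair₀ ε n) (shufflePair₁ ε n) := by
  have hE : 1 ≤ Real.exp ε := Real.one_le_exp hε
  refine dominatedBy_of_nonnegMeasure hδ (represents_shufflePair₀ hε n)
    (represents_shufflePair₁ hε n) ?_
  rw [← smul_mul_assoc, ← sub_mul]
  have hp : 0 ≤ (Real.exp ε + 1)⁻¹ := by positivity
  refine NonnegMeasure.mul ?_ ((nonnegMeasure_clone hp ?_).pow _)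
  · rw [smul_add, add_sub_add_comm]
    simp only [smul_single, ← single_sub, smul_eq_mul]
    refine (nonnegMeasure_single _ (by linarith)).add (nonnegMeasure_single _ ?_)
    nlinarith [mul_nonneg hp (mul_nonneg (by linarith : 0 ≤ Real.exp ε - 1)
      (by linarith : 0 ≤ Real.exp ε + 1))]
  · rw [← div_eq_mul_inv, div_le_one (by positivity)]
    linarith

/-- The infimum in the definition of `shuffleEps` is over a nonempty set, and it can be used like a
minimum because `DominatedBy` is a closed condition on `t`. -/
theorem dominatedBy_shuffleEps {M : Type*} {ε δ : ℝ} (hε : 0 ≤ ε) (hδ : 0 ≤ δ) {n : ℕ}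
    {p q : PMF M}
    (h : ∀ t, 0 ≤ t → DominatedBy t δ (shufflePair₀ ε n) (shufflePair₁ ε n) →
      DominatedBy t δ p q) :
    DominatedBy (shuffleEps ε n δ) δ p q := by
  intro O
  set s := {t : ℝ | 0 ≤ t ∧ DominatedBy t δ (shufflePair₀ ε n) (shufflePair₁ ε n) ∧
    DominatedBy t δ (shufflePair₁ ε n) (shufflePair₀ ε n)} with hs
  have hne : s.Nonempty := ⟨ε, hε, dominatedBy_shufflePair_self hε hδ n,
    dominatedBy_shufflePair_swap (dominatedBy_shufflePair_self hε hδ n)⟩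
  have hq : q.toOuterMeasure O ≠ ⊤ := by
    rw [PMF.toOuterMeasure_apply]
    exact q.tsum_coe_indicator_ne_top O
  have hcont : Continuous fun t : ℝ =>
      ENNReal.ofReal (Real.exp t) * q.toOuterMeasure O + ENNReal.ofReal δ :=
    ((ENNReal.continuous_mul_const hq).comp
      (ENNReal.continuous_ofReal.comp Real.continuous_exp)).add continuous_const
  have hclosed : IsClosed {t : ℝ | p.toOuterMeasure O ≤
      ENNReal.ofReal (Real.exp t) * q.toOuterMeasure O + ENNReal.ofReal δ} :=
    isClosed_le continuous_const hcont
  exact hclosed.closure_subset_iff.2 (fun t ht => h t ht.1 ht.2.1 O)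
    (csInf_mem_closure hne ⟨0, fun t ht => ht.1⟩)

theorem shuffleEps_le {ε t δ : ℝ} {n : ℕ} (ht : 0 ≤ t)
    (h : DominatedBy t δ (shufflePair₀ ε n) (shufflePair₁ ε n)) : shuffleEps ε n δ ≤ t :=
  csInf_le ⟨0, fun _ h => h.1⟩ ⟨ht, h, dominatedBy_shufflePair_swap h⟩

/-- It suffices to bound the probability that the likelihood ratio exceeds `e ^ t`. -/
theorem dominatedBy_shufflePair_of_tail {ε t δ : ℝ} (hε : 0 ≤ ε) (hδ : 0 ≤ δ) {n : ℕ} (hn : 0 < n)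
    (h : (shufflePair₀ ε n).toOuterMeasure {m | Real.exp t * countForm 1 (Real.exp ε) m <
      countForm (Real.exp ε) 1 m} ≤ ENNReal.ofReal δ) :
    DominatedBy t δ (shufflePair₀ ε n) (shufflePair₁ ε n) := by
  obtain ⟨r, rfl⟩ : ∃ r, n = r + 1 := ⟨n - 1, by omega⟩
  have r₀ := represents_shufflePair₀ hε (r + 1)
  have r₁ := represents_shufflePair₁ hε (r + 1)
  rw [r₀.toOuterMeasure_apply, ENNReal.ofReal_le_ofReal_iff hδ] at h
  refine (dominatedBy_iff hδ r₀ r₁).2 fun O => le_trans ?_ h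
  have w₀ := weightBy_clone_pow (Real.exp ε) 1 (Real.exp ε + 1)⁻¹ r
  have w₁ := weightBy_clone_pow 1 (Real.exp ε) (Real.exp ε + 1)⁻¹ r
  rw [one_mul] at w₀ w₁
  have hr : (0 : ℝ) < r + 1 := by positivity
  refine le_of_mul_le_mul_left ?_ hr
  rw [Nat.add_sub_cancel, ← smul_eq_mul (r + 1 : ℝ), ← smul_eq_mul (r + 1 : ℝ), ← map_smul,
    ← map_smul, ← w₀, smul_sub,
    smul_comm, ← w₁, ← w₀, map_sub, map_smul, expect_weightBy, expect_weightBy, expect_weightBy,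
    sub_le_iff_le_add, ← expect_smul_left, ← expect_add_left]
  refine ((nonnegMeasure_clone (by positivity) ?_).pow _).expect_mono fun m => ?_
  · rw [← div_eq_mul_inv, div_le_one (by positivity)]
    linarith [Real.one_le_exp hε]
  · have p0 : 0 ≤ countForm (Real.exp ε) 1 m := by rw [countForm_apply]; positivity
    have p1 : 0 ≤ Real.exp t * countForm 1 (Real.exp ε) m := by rw [countForm_apply]; positivity
    simp only [Set.indicator, Set.mem_ofPred_eq, smul_eq_mul]
    split_ifs <;> linarith

end ShuffleEps

/-! ### Tail bounds for the binomial law -/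

section Tails

theorem toOuterMeasure_bind_le {M N : Type*} (p : PMF M) (f : M → PMF N) (S : Set N) (Bad : Set M)
    (c : ENNReal) (h : ∀ m ∉ Bad, (f m).toOuterMeasure S ≤ c) :
    (p.bind f).toOuterMeasure S ≤ p.toOuterMeasure Bad + c := by
  rw [PMF.toOuterMeasure_bind_apply, PMF.toOuterMeasure_apply]
  calc ∑' m, p m * (f m).toOuterMeasure S ≤ ∑' m, (Bad.indicator p m + p m * c) := by
        refine ENNReal.tsum_le_tsum fun m => ?_
        by_cases hm : m ∈ Bad
        · rw [Set.indicator_of_mem hm]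
          refine le_add_right (mul_le_of_le_one_right' ?_)
          refine ((f m).toOuterMeasure.mono (Set.subset_univ S)).trans (le_of_eq ?_)
          exact (PMF.toOuterMeasure_apply_eq_one_iff _ _).2 (Set.subset_univ _)
        · exact le_add_left (mul_le_mul_right (h m hm) _)
    _ = ∑' m, Bad.indicator p m + c := by
        rw [ENNReal.tsum_add, ENNReal.tsum_mul_right, p.tsum_coe, one_mul]

/-- The Chernoff bound for the binomial law: `𝔼[x ^ k y ^ (m - k)] = (q x + (1 - q) y) ^ m`. -/
theorem binomialLaw_toOuterMeasure_le {m : ℕ} {q x y c : ℝ} (hq : 0 ≤ q) (hq' : q ≤ 1)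
    (hx : 0 ≤ x) (hy : 0 ≤ y) (hc : 0 ≤ c) {S : Set ℕ}
    (hS : ∀ k ∈ S, 1 ≤ c * (x ^ k * y ^ (m - k))) :
    (binomialLaw m q).toOuterMeasure S ≤ ENNReal.ofReal (c * (q * x + (1 - q) * y) ^ m) := by
  have h := represents_binomialLaw m hq hq'
  rw [h.toOuterMeasure_apply]
  refine ENNReal.ofReal_le_ofReal ?_
  have e := add_pow_eq_expect m q (1 - q) x y
  rw [smul_eq_mul, smul_eq_mul] at e
  rw [e, ← smul_eq_mul, ← expect_smul_left]
  refine h.nonneg.expect_mono fun k => ?_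
  by_cases hk : k ∈ S
  · rw [Set.indicator_of_mem hk]; exact hS k hk
  · rw [Set.indicator_of_notMem hk, smul_eq_mul]; positivity

/-- Hoeffding's inequality for fair coins. -/
theorem binomialLaw_half_tail {C : ℕ} {L : ℝ} (hL : 0 < L) (hC : 8 * L ≤ C) :
    (binomialLaw C (1 / 2)).toOuterMeasure {A | √(2 * C * L) < 2 * A - C} ≤
      ENNReal.ofReal (Real.exp (-L)) := by
  have hC0 : (0 : ℝ) < C := by linarith
  set s := √(2 * C * L) with hs
  have hs0 : 0 ≤ s := Real.sqrt_nonneg _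
  have hsC : s ≤ C := Real.sqrt_le_iff.2 ⟨hC0.le, by nlinarith⟩
  have hs2 : s ^ 2 = 2 * C * L := Real.sq_sqrt (by positivity)
  set l := s / C with hl
  have hl0 : 0 ≤ l := by positivity
  refine (binomialLaw_toOuterMeasure_le (x := Real.exp l) (y := Real.exp (-l))
    (c := Real.exp (-(l * s))) (by norm_num) (by norm_num) (Real.exp_pos _).le (Real.exp_pos _).le
    (Real.exp_pos _).le fun k hk => ?_).trans (ENNReal.ofReal_le_ofReal ?_)
  · rw [Set.mem_ofPred_eq] at hk
    rw [← Real.exp_nat_mul, ← Real.exp_nat_mul, ← Real.exp_add, ← Real.exp_add]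
    refine Real.one_le_exp ?_
    rcases le_total k C with h | h
    · rw [Nat.cast_sub h]
      nlinarith
    · rw [Nat.sub_eq_zero_of_le h]
      have : (C : ℝ) ≤ k := by exact_mod_cast h
      push_cast
      nlinarith
  · have e : 1 / 2 * Real.exp l + (1 - 1 / 2) * Real.exp (-l) = Real.cosh l := by
      rw [Real.cosh_eq]; ring
    rw [e]
    calc Real.exp (-(l * s)) * Real.cosh l ^ C
        ≤ Real.exp (-(l * s)) * Real.exp (l ^ 2 / 2) ^ C := by
          have := (Real.cosh_pos l).le
          gcongr
          exact Real.cosh_le_exp_half_sq l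
      _ = Real.exp (-L) := by
          rw [← Real.exp_nat_mul, ← Real.exp_add, hl]
          congr 1
          field_simp
          rw [hs2]
          ring

/-- The number of clones is at least half its mean up to an exponentially small probability. -/
theorem binomialLaw_lower_tail {n : ℕ} {p L : ℝ} (hp0 : 0 ≤ p) (hp : p ≤ 1 / 2) (hn : 0 < n)
    (hL : Real.log 2 ≤ L) (hnp : 8 * L ≤ n * p) :
    (binomialLaw (n - 1) (2 * p)).toOuterMeasure {C | (C : ℝ) < n * p} ≤
      ENNReal.ofReal (Real.exp (-L)) := by
  refine (binomialLaw_toOuterMeasure_le (x := 1 / 2) (y := 1)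
    (c := Real.exp (n * p * Real.log 2)) (by linarith) (by linarith) (by norm_num) (by norm_num)
    (Real.exp_pos _).le fun k hk => ?_).trans (ENNReal.ofReal_le_ofReal ?_)
  · rw [Set.mem_ofPred_eq] at hk
    have : (1 / 2 : ℝ) ^ k = Real.exp (-(k * Real.log 2)) := by
      rw [Real.exp_neg, Real.exp_nat_mul, Real.exp_log two_pos, one_div, inv_pow]
    rw [one_pow, mul_one, this, ← Real.exp_add]
    refine Real.one_le_exp ?_
    have := Real.log_pos one_lt_two
    nlinarith
  · have e : 2 * p * (1 / 2) + (1 - 2 * p) * 1 = 1 - p := by ring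
    rw [e]
    calc Real.exp (n * p * Real.log 2) * (1 - p) ^ (n - 1)
        ≤ Real.exp (n * p * Real.log 2) * Real.exp (-p) ^ (n - 1) := by
          gcongr
          · linarith
          · exact Real.one_sub_le_exp_neg p
      _ = Real.exp (n * p * Real.log 2 - (n - 1) * p) := by
          rw [← Real.exp_nat_mul, ← Real.exp_add, Nat.cast_sub hn]
          congr 1
          push_cast
          ring
      _ ≤ Real.exp (-L) := by
          refine Real.exp_le_exp.2 ?_
          have h1 := Real.log_two_lt_d9
          have h2 := Real.log_two_gt_d9
          nlinarith

end Tails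

/-! ### The closed form of the privacy parameter -/

section ClosedForm

/-- The likelihood ratio at typical counts. -/
theorem ratio_le_of_typical {E C a b s τ : ℝ} (hE : 1 ≤ E) (hC : 0 ≤ C) (hab : a + b = C + 1)
    (ha : 0 ≤ a) (hb : C / 4 ≤ b) (hd : a - b ≤ s + 1) (hτ : 0 ≤ τ)
    (hs : s + 1 ≤ τ * ((E + 1) * (C / 4))) :
    E * a + b ≤ (1 + (E - 1) * τ) * (a + E * b) := by
  have key : a - b ≤ τ * (a + E * b) := by
    rcases le_total a b with h | h
    · have : 0 ≤ τ * (a + E * b) := by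
        have : 0 ≤ b := by linarith
        positivity
      linarith
    · refine (hd.trans hs).trans (mul_le_mul_of_nonneg_left ?_ hτ)
      nlinarith
  nlinarith [mul_le_mul_of_nonneg_left key (by linarith : 0 ≤ E - 1)]

/-- The bound `n ≤ C (E + 1)` says that the number `C` of clones is at least half of
`2 n / (E + 1)`. -/
theorem sqrt_add_one_le {E C L L' n : ℝ} (hE : 0 < E) (hn : 0 < n) (hL : 0 ≤ L) (hLL : L ≤ L')
    (hC : n ≤ C * (E + 1)) :
    √(2 * C * L) + 1 ≤ (4 * √(2 * L') / √((E + 1) * n) + 4 / n) * ((E + 1) * (C / 4)) := by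
  have hC0 : 0 < C := by
    by_contra h
    nlinarith
  have h1 : √(2 * C * L) ≤ √(2 * L') * ((E + 1) * C / √((E + 1) * n)) := by
    rw [show 2 * C * L = 2 * L * C by ring, Real.sqrt_mul (by positivity)]
    refine mul_le_mul (Real.sqrt_le_sqrt (by linarith)) ?_ (Real.sqrt_nonneg _) (Real.sqrt_nonneg _)
    rw [le_div_iff₀ (by positivity), ← Real.sqrt_mul hC0.le]
    refine Real.sqrt_le_iff.2 ⟨by positivity, ?_⟩
    calc C * ((E + 1) * n) ≤ C * ((E + 1) * (C * (E + 1))) := by gcongr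
      _ = _ := by ring
  have h2 : 1 ≤ (E + 1) * C / n := by
    rw [le_div_iff₀ hn]; linarith
  calc √(2 * C * L) + 1 ≤ √(2 * L') * ((E + 1) * C / √((E + 1) * n)) + (E + 1) * C / n :=
        add_le_add h1 h2
    _ = _ := by ring

theorem shuffleEps_le_log {ε δ : ℝ} {n : ℕ} (hε : 0 ≤ ε) (hn : 0 < n) (hδ : 0 < δ) (hδ' : δ ≤ 1)
    (h : (Real.exp ε + 1) * (8 * Real.log (2 / δ)) ≤ n) :
    shuffleEps ε n δ ≤ Real.log (1 + (Real.exp ε - 1) *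
      (4 * √(2 * Real.log (4 / δ)) / √((Real.exp ε + 1) * n) + 4 / n)) := by
  have hE : 1 ≤ Real.exp ε := Real.one_le_exp hε
  have hn0 : (0 : ℝ) < n := by exact_mod_cast hn
  set E := Real.exp ε
  set L := Real.log (2 / δ) with hL
  set τ := 4 * √(2 * Real.log (4 / δ)) / √((E + 1) * n) + 4 / n with hτ
  have hτ0 : 0 ≤ τ := by positivity
  have hL2 : Real.log 2 ≤ L := Real.log_le_log two_pos (by rw [le_div_iff₀ hδ]; linarith)
  have hL0 : 0 < L := (Real.log_pos one_lt_two).trans_le hL2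
  have hLL : L ≤ Real.log (4 / δ) := Real.log_le_log (by positivity) (by gcongr; norm_num)
  have hexpL : Real.exp (-L) = δ / 2 := by
    rw [hL, Real.exp_neg, Real.exp_log (by positivity), inv_div]
  have h1 : 1 ≤ 1 + (E - 1) * τ := by
    have := mul_nonneg (by linarith : 0 ≤ E - 1) hτ0
    linarith
  refine shuffleEps_le (Real.log_nonneg h1) (dominatedBy_shufflePair_of_tail hε hδ.le hn ?_)
  rw [Real.exp_log (by linarith)]
  have hnp : 8 * L ≤ n * (E + 1)⁻¹ := by
    rw [← div_eq_mul_inv, le_div_iff₀ (by positivity)]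
    linarith
  have hsum : ENNReal.ofReal δ = ENNReal.ofReal (δ / 2) + ENNReal.ofReal (δ / 2) := by
    rw [← ENNReal.ofReal_add (by positivity) (by positivity), add_halves]
  rw [hsum, ← hexpL]
  have hq : 2 / (Real.exp ε + 1) = 2 * (E + 1)⁻¹ := div_eq_mul_inv _ _
  unfold shufflePair₀
  refine le_trans (toOuterMeasure_bind_le _ _ _ {C : ℕ | (C : ℝ) < n * (E + 1)⁻¹}
    (ENNReal.ofReal (Real.exp (-L))) fun C hC => ?_) (add_le_add ?_ le_rfl)
  · rw [Set.mem_ofPred_eq, not_lt] at hC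
    have hC8 : 8 * L ≤ C := hnp.trans hC
    have hCn : (n : ℝ) ≤ C * (E + 1) := by
      rwa [← div_eq_mul_inv, div_le_iff₀ (by positivity)] at hC
    refine (toOuterMeasure_bind_le _ _ _ {A : ℕ | √(2 * C * L) < 2 * A - C} 0
      fun A hA => ?_).trans ?_
    · rw [Set.mem_ofPred_eq, not_lt] at hA
      have hs : √(2 * C * L) ≤ C / 2 := Real.sqrt_le_iff.2 ⟨by positivity, by nlinarith⟩
      have hA4 : (A : ℝ) ≤ 3 * C / 4 := by linarith
      have hAC : A ≤ C := by
        have : (A : ℝ) ≤ C := by linarith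
        exact_mod_cast this
      have hbound := sqrt_add_one_le (by linarith : 0 < E) hn0 hL0.le hLL hCn
      rw [nonpos_iff_eq_zero, PMF.toOuterMeasure_apply_eq_zero_iff, Set.disjoint_left]
      intro m hm
      rw [PMF.mem_support_map_iff] at hm
      obtain ⟨Δ, -, rfl⟩ := hm
      rw [Set.mem_ofPred_eq, not_lt]
      cases Δ
      · simp only [Bool.false_eq_true, if_false, countForm_apply, one_mul, Nat.cast_add,
          Nat.cast_sub hAC, Nat.cast_one]
        exact ratio_le_of_typical (C := C) hE (by positivity) (by ring) (by positivity)
          (by linarith) (by linarith) hτ0 hbound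
      · simp only [if_true, countForm_apply, one_mul, Nat.cast_add, Nat.cast_sub hAC, Nat.cast_one]
        exact ratio_le_of_typical (C := C) hE (by positivity) (by ring) (by positivity)
          (by linarith) (by linarith) hτ0 hbound
    · rw [add_zero]
      exact binomialLaw_half_tail hL0 hC8
  · rw [hq]
    refine binomialLaw_lower_tail (by positivity) ?_ hn hL2 hnp
    rw [one_div]
    exact inv_anti₀ two_pos (by linarith)

end ClosedForm

/-! ### Mixtures and post-processing -/

section Mixtures

variable {M N Ω : Type*} {t δ : ℝ}

theorem DominatedBy.refl (ht : 0 ≤ t) (p : PMF M) : DominatedBy t δ p p := fun _ =>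
  le_add_right (le_mul_of_one_le_left' (ENNReal.one_le_ofReal.2 (Real.one_le_exp ht)))

theorem DominatedBy.bind_left {p : PMF Ω} {f g : Ω → PMF M}
    (h : ∀ x ∈ p.support, DominatedBy t δ (f x) (g x)) :
    DominatedBy t δ (p.bind f) (p.bind g) := fun O => by
  rw [PMF.toOuterMeasure_bind_apply, PMF.toOuterMeasure_bind_apply]
  calc ∑' x, p x * (f x).toOuterMeasure O
      ≤ ∑' x, (ENNReal.ofReal (Real.exp t) * (p x * (g x).toOuterMeasure O) +
          p x * ENNReal.ofReal δ) := by
        refine ENNReal.tsum_le_tsum fun x => ?_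
        by_cases hx : x ∈ p.support
        · refine (mul_le_mul_right (h x hx O) _).trans (le_of_eq ?_)
          ring
        · simp [(p.apply_eq_zero_iff x).2 hx]
    _ = _ := by
        rw [ENNReal.tsum_add, ENNReal.tsum_mul_left, ENNReal.tsum_mul_right, p.tsum_coe, one_mul]

/-- Joint convexity for two unrelated mixing laws. -/
theorem DominatedBy.bind_bind {N' : Type*} {p : PMF N} {q : PMF N'} {f : N → PMF M} {g : N' → PMF M}
    (h : ∀ x ∈ p.support, ∀ y ∈ q.support, DominatedBy t δ (f x) (g y)) :
    DominatedBy t δ (p.bind f) (q.bind g) := by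
  rw [← PMF.bind_const p (q.bind g)]
  refine bind_left fun x hx => ?_
  rw [← PMF.bind_const q (f x)]
  exact bind_left fun y hy => h x hx y hy

/-- Post-processing by a randomized map. -/
theorem DominatedBy.bind {p q : PMF M} (h : DominatedBy t δ p q) (f : M → PMF N) :
    DominatedBy t δ (p.bind f) (q.bind f) := fun O => by
  set E := ENNReal.ofReal (Real.exp t) with hE
  have hexc : ∑' x, (p x - E * q x) ≤ ENNReal.ofReal δ := by
    set S : Set M := {x | E * q x ≤ p x} with hS
    have h1 : ∀ x, p x - E * q x = S.indicator p x - E * S.indicator q x := fun x => by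
      by_cases hx : x ∈ S
      · rw [Set.indicator_of_mem hx, Set.indicator_of_mem hx]
      · rw [Set.indicator_of_notMem hx, Set.indicator_of_notMem hx, tsub_eq_zero_of_le]
        · simp
        · exact (not_le.1 hx).le
    have h2 : ∑' x, E * S.indicator q x ≠ ⊤ := by
      rw [ENNReal.tsum_mul_left]
      exact ENNReal.mul_ne_top ENNReal.ofReal_ne_top (q.tsum_coe_indicator_ne_top S)
    have h3 : ∀ x, E * S.indicator q x ≤ S.indicator p x := fun x => by
      by_cases hx : x ∈ S
      · rw [Set.indicator_of_mem hx, Set.indicator_of_mem hx]; exact hx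
      · simp [Set.indicator_of_notMem hx]
    refine (ENNReal.add_le_add_iff_right h2).1 ?_
    rw [← ENNReal.tsum_add]
    simp only [h1, tsub_add_cancel_of_le (h3 _)]
    have := h S
    rwa [PMF.toOuterMeasure_apply, PMF.toOuterMeasure_apply, ← ENNReal.tsum_mul_left,
      add_comm] at this
  rw [PMF.toOuterMeasure_bind_apply, PMF.toOuterMeasure_bind_apply]
  calc ∑' x, p x * (f x).toOuterMeasure O
      ≤ ∑' x, (E * (q x * (f x).toOuterMeasure O) + (p x - E * q x)) := by
        refine ENNReal.tsum_le_tsum fun x => ?_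
        have hf : (f x).toOuterMeasure O ≤ 1 :=
          ((f x).toOuterMeasure.mono (Set.subset_univ O)).trans
            (le_of_eq ((PMF.toOuterMeasure_apply_eq_one_iff _ _).2 (Set.subset_univ _)))
        calc p x * (f x).toOuterMeasure O
            ≤ (E * q x + (p x - E * q x)) * (f x).toOuterMeasure O := by
              gcongr; exact le_add_tsub
          _ ≤ _ := by
              rw [add_mul, mul_assoc]
              gcongr
              exact mul_le_of_le_one_right' hf
    _ ≤ _ := by
        rw [ENNReal.tsum_add, ENNReal.tsum_mul_left]
        gcongr

end Mixtures

/-! ### Sums of independent draws -/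

section IndepSum

variable {M : Type*} [AddCommMonoid M]

theorem indepSum_cons (p : PMF M) (l : List (PMF M)) :
    indepSum (p :: l) = p.bind fun a => (indepSum l).map fun b => a + b := rfl

theorem indepSum_perm {l l' : List (PMF M)} (h : l.Perm l') : indepSum l = indepSum l' := by
  induction h with
  | nil => rfl
  | cons p _ ih => rw [indepSum_cons, indepSum_cons, ih]
  | swap p q l =>
    simp only [indepSum_cons, PMF.map_bind, PMF.map_comp, Function.comp_def]
    rw [PMF.bind_comm]
    simp only [add_left_comm]
  | trans _ _ ih₁ ih₂ => rw [ih₁, ih₂]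

theorem indepSum_append (l l' : List (PMF M)) :
    indepSum (l ++ l') = (indepSum l).bind fun a => (indepSum l').map fun b => a + b := by
  induction l with
  | nil =>
    change indepSum l' = (PMF.pure 0).bind _
    rw [PMF.pure_bind]
    simp only [zero_add]
    exact (PMF.map_id _).symm
  | cons p l ih =>
    rw [List.cons_append, indepSum_cons, indepSum_cons, ih, PMF.bind_bind]
    simp only [PMF.map_bind, PMF.bind_map, PMF.map_comp, Function.comp_def, add_assoc]

theorem indepSum_bind_cons {Ω : Type*} (s : PMF Ω) (f : Ω → List (PMF M)) (l : List (PMF M)) :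
    indepSum ((s.bind fun x => indepSum (f x)) :: l) = s.bind fun x => indepSum (f x ++ l) := by
  simp only [indepSum_cons, PMF.bind_bind, indepSum_append]

end IndepSum

/-! ### The votes of a cohort -/

section Cohort

variable {M Y ι : Type*} [AddCommMonoid M] {t δ : ℝ}

/-- The sum of the reports `R y` of the elements `y` of a randomly sampled list. -/
noncomputable def voteLaw (R : Y → PMF M) (s : PMF (List Y)) : PMF M :=
  s.bind fun T => indepSum (T.map R)

/-- The law of the votes depends on the sampled list only up to order. -/
theorem voteLaw_eq_of_multiset {Ω : Type*} {R : Y → PMF M} {s : PMF (List Y)} {ρ : PMF Ω}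
    {core : Ω → Multiset Y} {κ : Ω → PMF Y}
    (h : s.map Multiset.ofList = ρ.bind fun ω => (κ ω).map fun y => y ::ₘ core ω) :
    voteLaw R s = ρ.bind fun ω => (κ ω).bind fun y => indepSum (R y :: (core ω).toList.map R) := by
  have h1 : voteLaw R s = (s.map Multiset.ofList).bind fun m =>
      indepSum (m.toList.map R) := by
    rw [PMF.bind_map]
    refine congrArg s.bind (funext fun T => indepSum_perm (List.Perm.map R ?_))
    exact (Multiset.coe_eq_coe.1 (Multiset.coe_toList _)).symm
  rw [h1, h, PMF.bind_bind]
  refine congrArg ρ.bind (funext fun ω => ?_)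
  rw [PMF.bind_map]
  refine congrArg (κ ω).bind (funext fun y => indepSum_perm ?_)
  rw [← List.map_cons]
  refine List.Perm.map R (Multiset.coe_eq_coe.1 ?_)
  rw [Multiset.coe_toList, ← Multiset.cons_coe, Multiset.coe_toList]

/-- The sampled lists of the other users can be conditioned on one after the other. -/
theorem dominatedBy_cons_votes {R : Y → PMF M} {Good : Y → Prop} {n B : ℕ} {y y' : Y}
    (H : ∀ l : List Y, (∀ x ∈ l, Good x) → l.length + 1 = n →
      DominatedBy t δ (indepSum (R y :: l.map R)) (indepSum (R y' :: l.map R)))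
    {s : ι → PMF (List Y)} {js : List ι}
    (hs : ∀ j ∈ js, ∀ T ∈ (s j).support, T.length = B ∧ ∀ x ∈ T, Good x)
    {acc : List Y} (hacc : ∀ x ∈ acc, Good x) (hlen : acc.length + js.length * B + 1 = n) :
    DominatedBy t δ (indepSum (R y :: (acc.map R ++ js.map fun j => voteLaw R (s j))))
      (indepSum (R y' :: (acc.map R ++ js.map fun j => voteLaw R (s j)))) := by
  induction js generalizing acc with
  | nil =>
    simp only [List.map_nil, List.append_nil]
    exact H acc hacc (by simpa using hlen)
  | cons j js ih =>
    have e : ∀ z, indepSum (R z :: (acc.map R ++ (j :: js).map fun j => voteLaw R (s j))) =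
        (s j).bind fun T =>
          indepSum (R z :: ((T ++ acc).map R ++ js.map fun j => voteLaw R (s j))) := fun z => by
      have e1 : (R z :: (acc.map R ++ (j :: js).map fun j => voteLaw R (s j))).Perm
          (voteLaw R (s j) :: (R z :: (acc.map R ++ js.map fun j => voteLaw R (s j)))) := by
        rw [List.map_cons]
        exact (List.Perm.cons _ List.perm_middle).trans (List.Perm.swap _ _ _)
      rw [indepSum_perm e1, voteLaw, indepSum_bind_cons]
      refine congrArg (s j).bind (funext fun T => indepSum_perm ?_)
      rw [List.map_append, List.append_assoc]
      exact List.perm_middle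
    rw [e, e]
    refine DominatedBy.bind_left fun T hT => ih (fun k hk => hs k (List.mem_cons_of_mem _ hk)) ?_ ?_
    · intro x hx
      rcases List.mem_append.1 hx with h | h
      · exact (hs j List.mem_cons_self T hT).2 x h
      · exact hacc x h
    · rw [List.length_append, (hs j List.mem_cons_self T hT).1, ← hlen, List.length_cons]
      ring

/-- The votes of a cohort in which one user draws the sampled list from one of two laws that can be
coupled such that the lists differ in at most one element. -/
theorem dominatedBy_votes {Ω : Type*} {R : Y → PMF M} {Good : Y → Prop} {n B : ℕ}
    (H : ∀ y y', Good y → Good y' → ∀ l : List Y, (∀ x ∈ l, Good x) → l.length + 1 = n →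
      DominatedBy t δ (indepSum (R y :: l.map R)) (indepSum (R y' :: l.map R)))
    {s : ι → PMF (List Y)} {js : List ι}
    (hs : ∀ j ∈ js, ∀ T ∈ (s j).support, T.length = B ∧ ∀ x ∈ T, Good x)
    (hlen : (js.length + 1) * B = n)
    {u u' : PMF (List Y)} {ρ : PMF Ω} {core : Ω → Multiset Y} {κ κ' : Ω → PMF Y}
    (hu : u.map Multiset.ofList = ρ.bind fun ω => (κ ω).map fun y => y ::ₘ core ω)
    (hu' : u'.map Multiset.ofList = ρ.bind fun ω => (κ' ω).map fun y => y ::ₘ core ω)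
    (hus : ∀ T ∈ u.support, T.length = B ∧ ∀ x ∈ T, Good x)
    (hus' : ∀ T ∈ u'.support, T.length = B ∧ ∀ x ∈ T, Good x) :
    DominatedBy t δ (indepSum (voteLaw R u :: js.map fun j => voteLaw R (s j)))
      (indepSum (voteLaw R u' :: js.map fun j => voteLaw R (s j))) := by
  have hmem : ∀ (v : PMF (List Y)) (k : Ω → PMF Y),
      v.map Multiset.ofList = ρ.bind (fun ω => (k ω).map fun y => y ::ₘ core ω) →
      (∀ T ∈ v.support, T.length = B ∧ ∀ x ∈ T, Good x) →
      ∀ ω ∈ ρ.support, ∀ y ∈ (k ω).support,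
        (core ω).card + 1 = B ∧ Good y ∧ ∀ x ∈ core ω, Good x := by
    intro v k hv hvs ω hω y hy
    have h1 : y ::ₘ core ω ∈ (v.map Multiset.ofList).support := by
      rw [hv, PMF.mem_support_bind_iff]
      exact ⟨ω, hω, (PMF.mem_support_map_iff _ _ _).2 ⟨y, hy, rfl⟩⟩
    obtain ⟨T, hT, hTe⟩ := (PMF.mem_support_map_iff _ _ _).1 h1
    obtain ⟨hTl, hTg⟩ := hvs T hT
    have hx : ∀ x ∈ y ::ₘ core ω, Good x := fun x hx => hTg x (by rwa [← hTe] at hx)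
    refine ⟨?_, hx y (Multiset.mem_cons_self _ _), fun x h => hx x (Multiset.mem_cons_of_mem h)⟩
    rw [← Multiset.card_cons y, ← hTe, Multiset.coe_card, hTl]
  have e : ∀ (v : PMF (List Y)) (k : Ω → PMF Y),
      v.map Multiset.ofList = ρ.bind (fun ω => (k ω).map fun y => y ::ₘ core ω) →
      indepSum (voteLaw R v :: js.map fun j => voteLaw R (s j)) = ρ.bind fun ω => (k ω).bind fun y =>
        indepSum (R y :: ((core ω).toList.map R ++ js.map fun j => voteLaw R (s j))) := by
    intro v k hv
    rw [indepSum_cons, voteLaw_eq_of_multiset hv, PMF.bind_bind]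
    refine congrArg ρ.bind (funext fun ω => ?_)
    rw [PMF.bind_bind]
    refine congrArg (k ω).bind (funext fun y => ?_)
    rw [← indepSum_append, List.cons_append]
  rw [e u κ hu, e u' κ' hu']
  refine DominatedBy.bind_left fun ω hω => DominatedBy.bind_bind fun y hy y' hy' => ?_
  obtain ⟨h1, h2, h3⟩ := hmem u κ hu hus ω hω y hy
  obtain ⟨-, h2', -⟩ := hmem u' κ' hu' hus' ω hω y' hy'
  refine dominatedBy_cons_votes (H y y' h2 h2') hs (fun x hx => h3 x (Multiset.mem_toList.1 hx)) ?_
  rw [Multiset.length_toList, ← hlen, ← h1]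
  ring

end Cohort

/-! ### Subset selection -/

section SubsetSelection

variable {α : Type*} [DecidableEq α]

theorem PointwiseClose.map {M N : Type*} {ε : ℝ} {p q : PMF M} (h : PointwiseClose ε p q)
    (f : M → N) : PointwiseClose ε (p.map f) (q.map f) := fun m => by
  rw [PMF.map_apply, PMF.map_apply, ← ENNReal.tsum_mul_left]
  refine ENNReal.tsum_le_tsum fun x => ?_
  split_ifs
  · exact h x
  · simp

theorem ssSize_pos {ε : ℝ} {s : ℕ} (hs : 0 < s) : 0 < ssSize ε s :=
  Nat.ceil_pos.2 (by positivity)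

theorem ssSize_le {ε : ℝ} (s : ℕ) : ssSize ε s ≤ s :=
  Nat.ceil_le.2 (div_le_self (by positivity) (by linarith [Real.exp_pos ε]))

theorem coin_true {p : ℝ} (hp : p ≤ 1) : coin p true = ENNReal.ofReal p := by
  simp [coin, ENNReal.ofReal_le_one.2 hp]

theorem coin_false {p : ℝ} (hp0 : 0 ≤ p) (hp : p ≤ 1) : coin p false = ENNReal.ofReal (1 - p) := by
  simp [coin, ENNReal.ofReal_le_one.2 hp, ENNReal.ofReal_sub _ hp0]

theorem bind_bool {M : Type*} (p : PMF Bool) (f : Bool → PMF M) (m : M) :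
    p.bind f m = p true * f true m + p false * f false m := by
  rw [PMF.bind_apply, tsum_bool, add_comm]

theorem uniformSubset_apply (k : ℕ) (T v : Finset α) :
    uniformSubset k T v = if v ∈ T.powersetCard (min k T.card) then
      ((T.card.choose (min k T.card) : ℕ) : ENNReal)⁻¹ else 0 := by
  rw [uniformSubset, PMF.uniformOfFinset_apply, Finset.card_powersetCard]
  split_ifs <;> rfl

theorem map_insert_apply {z : α} {p : PMF (Finset α)} (hp : ∀ u ∈ p.support, z ∉ u)
    (v : Finset α) : p.map (insert z) v = if z ∈ v then p (v.erase z) else 0 := by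
  rw [PMF.map_apply]
  split_ifs with hz
  · rw [tsum_eq_single (v.erase z)]
    · rw [if_pos (Finset.insert_erase hz).symm]
    · intro u hu
      split_ifs with h
      · rw [PMF.apply_eq_zero_iff]
        intro hs
        exact hu (by rw [h, Finset.erase_insert (hp u hs)])
      · rfl
  · rw [ENNReal.tsum_eq_zero]
    intro u
    rw [if_neg]
    rintro rfl
    exact hz (Finset.mem_insert_self _ _)

theorem ssProb_nonneg {ε : ℝ} (s : ℕ) : 0 ≤ ssProb ε s := by
  have : (ssSize ε s : ℝ) ≤ s := by exact_mod_cast ssSize_le s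
  unfold ssProb
  rw [add_sub_assoc]
  have := sub_nonneg.2 this
  positivity

theorem ssProb_denom_pos {ε : ℝ} {s : ℕ} (hs : 0 < s) :
    0 < (ssSize ε s : ℝ) * Real.exp ε + s - ssSize ε s := by
  have h1 : (ssSize ε s : ℝ) ≤ s := by exact_mod_cast ssSize_le s
  have h2 : (0 : ℝ) < ssSize ε s := by exact_mod_cast ssSize_pos hs
  have := mul_pos h2 (Real.exp_pos ε)
  linarith

theorem one_sub_ssProb {ε : ℝ} {s : ℕ} (hs : 0 < s) : 1 - ssProb ε s =
    (s - ssSize ε s) / ((ssSize ε s : ℝ) * Real.exp ε + s - ssSize ε s) := by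
  have := (ssProb_denom_pos (ε := ε) hs).ne'
  unfold ssProb
  field_simp
  ring

theorem ssProb_le_one {ε : ℝ} {s : ℕ} (hs : 0 < s) : ssProb ε s ≤ 1 := by
  have h1 : (ssSize ε s : ℝ) ≤ s := by exact_mod_cast ssSize_le s
  have := div_nonneg (sub_nonneg.2 h1) (ssProb_denom_pos (ε := ε) hs).le
  rw [← one_sub_ssProb hs] at this
  linarith

/-- Subset selection reports a set of the prescribed size, and its probability only depends on
whether it contains the input. -/
theorem subsetSelection_apply {ε : ℝ} {𝒵 : Finset α} {z : α} (hz : z ∈ 𝒵) (v : Finset α) :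
    subsetSelection ε 𝒵 z v = ENNReal.ofReal
      (if v ∈ 𝒵.powersetCard (ssSize ε 𝒵.card) then
        if z ∈ v then ssProb ε 𝒵.card / (𝒵.card - 1).choose (ssSize ε 𝒵.card - 1)
        else (1 - ssProb ε 𝒵.card) / (𝒵.card - 1).choose (ssSize ε 𝒵.card)
      else 0) := by
  have hs : 0 < 𝒵.card := Finset.card_pos.2 ⟨z, hz⟩
  have hd := ssSize_pos (ε := ε) hs
  have hd' := ssSize_le (ε := ε) 𝒵.card
  have hp0 := ssProb_nonneg (ε := ε) 𝒵.card
  have hp1 := ssProb_le_one (ε := ε) hs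
  have hp : 1 - ssProb ε 𝒵.card = _ := one_sub_ssProb hs
  set s := 𝒵.card with hs'
  set d := ssSize ε s with hd''
  have hce : (𝒵.erase z).card = s - 1 := Finset.card_erase_of_mem hz
  rw [subsetSelection, bind_bool, coin_true hp1, coin_false hp0 hp1]
  simp only [if_true, Bool.false_eq_true, if_false, ← hs', ← hd'']
  rw [map_insert_apply]
  swap
  · intro u hu
    rw [PMF.mem_support_iff, uniformSubset_apply] at hu
    split_ifs at hu with h
    · exact fun hzu => Finset.notMem_erase z 𝒵 ((Finset.mem_powersetCard.1 h).1 hzu)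
    · exact absurd rfl hu
  rw [uniformSubset_apply, uniformSubset_apply, hce, min_eq_left (by omega : d - 1 ≤ s - 1)]
  have hchoose : (0 : ℝ) < (s - 1).choose (d - 1) := by
    exact_mod_cast Nat.choose_pos (by omega)
  by_cases hzv : z ∈ v
  · have h1 : v ∉ (𝒵.erase z).powersetCard (min d (s - 1)) := fun h =>
      Finset.notMem_erase z 𝒵 ((Finset.mem_powersetCard.1 h).1 hzv)
    have h2 : v.erase z ∈ (𝒵.erase z).powersetCard (d - 1) ↔ v ∈ 𝒵.powersetCard d := by
      simp only [Finset.mem_powersetCard, Finset.card_erase_of_mem hzv]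
      have : 0 < v.card := Finset.card_pos.2 ⟨z, hzv⟩
      refine and_congr ⟨fun h => ?_, fun h => Finset.erase_subset_erase z h⟩ (by omega)
      rw [← Finset.insert_erase hzv]
      exact Finset.insert_subset hz (h.trans (Finset.erase_subset _ _))
    simp only [if_pos hzv, if_neg h1, h2, mul_zero, add_zero]
    split_ifs
    · rw [ENNReal.ofReal_div_of_pos hchoose, ENNReal.ofReal_natCast, div_eq_mul_inv]
    · simp
  · simp only [if_neg hzv, mul_zero, zero_add]
    rcases lt_or_eq_of_le hd' with hlt | heq
    · have h2 : v ∈ (𝒵.erase z).powersetCard d ↔ v ∈ 𝒵.powersetCard d := by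
        simp only [Finset.mem_powersetCard, Finset.subset_erase]
        tauto
      have hchoose' : (0 : ℝ) < (s - 1).choose d := by
        exact_mod_cast Nat.choose_pos (by omega)
      rw [min_eq_left (by omega)]
      simp only [h2]
      split_ifs
      · rw [ENNReal.ofReal_div_of_pos hchoose', ENNReal.ofReal_natCast, div_eq_mul_inv]
      · simp
    · -- all of `𝒵` is reported, so that the input is never left out
      rw [hp, heq]
      simp

theorem finite_support_subsetSelection {ε : ℝ} {𝒵 : Finset α} {z : α} (hz : z ∈ 𝒵) :
    (subsetSelection ε 𝒵 z).support.Finite := by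
  refine (𝒵.powersetCard (ssSize ε 𝒵.card)).finite_toSet.subset fun v hv => ?_
  rw [PMF.mem_support_iff, subsetSelection_apply hz] at hv
  by_contra h
  rw [Finset.mem_coe] at h
  simp [h] at hv

/-- Subset selection is an `ε`-LDP randomizer. -/
theorem pointwiseClose_subsetSelection {ε : ℝ} (hε : 0 ≤ ε) {𝒵 : Finset α} {z z' : α}
    (hz : z ∈ 𝒵) (hz' : z' ∈ 𝒵) :
    PointwiseClose ε (subsetSelection ε 𝒵 z) (subsetSelection ε 𝒵 z') := fun v => by
  rw [subsetSelection_apply hz, subsetSelection_apply hz', ← ENNReal.ofReal_mul (Real.exp_pos ε).le]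
  refine ENNReal.ofReal_le_ofReal ?_
  have hs : 0 < 𝒵.card := Finset.card_pos.2 ⟨z, hz⟩
  have hd := ssSize_pos (ε := ε) hs
  have hp0 := ssProb_nonneg (ε := ε) 𝒵.card
  have hp1 := ssProb_le_one (ε := ε) hs
  have hE := Real.one_le_exp hε
  by_cases hv : v ∈ 𝒵.powersetCard (ssSize ε 𝒵.card)
  swap
  · simp [hv]
  simp only [if_pos hv]
  set hi := ssProb ε 𝒵.card / (𝒵.card - 1).choose (ssSize ε 𝒵.card - 1) with hhi
  set lo := (1 - ssProb ε 𝒵.card) / (𝒵.card - 1).choose (ssSize ε 𝒵.card) with hlo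
  have hhi0 : 0 ≤ hi := by positivity
  have hlo0 : 0 ≤ lo := div_nonneg (by linarith) (by positivity)
  -- a set that misses an element of `𝒵` exists only if it is not all of `𝒵`
  have key : ∀ x ∈ 𝒵, x ∉ v → hi = Real.exp ε * lo := fun x hx hxv => by
    obtain ⟨hv1, hv2⟩ := Finset.mem_powersetCard.1 hv
    have hlt : ssSize ε 𝒵.card < 𝒵.card := by
      rw [← hv2]
      exact Finset.card_lt_card ⟨hv1, fun h => hxv (h hx)⟩
    have hc : ((𝒵.card - 1).choose (ssSize ε 𝒵.card) : ℝ) * ssSize ε 𝒵.card =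
        (𝒵.card - 1).choose (ssSize ε 𝒵.card - 1) * (𝒵.card - ssSize ε 𝒵.card) := by
      have := Nat.choose_succ_right_eq (𝒵.card - 1) (ssSize ε 𝒵.card - 1)
      rw [Nat.sub_add_cancel hd, show 𝒵.card - 1 - (ssSize ε 𝒵.card - 1) =
        𝒵.card - ssSize ε 𝒵.card by omega] at this
      rw [← Nat.cast_sub hlt.le]
      exact_mod_cast this
    have h1 : ((𝒵.card - 1).choose (ssSize ε 𝒵.card) : ℝ) ≠ 0 := by
      exact_mod_cast (Nat.choose_pos (by omega)).ne'
    have h2 : ((𝒵.card - 1).choose (ssSize ε 𝒵.card - 1) : ℝ) ≠ 0 := by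
      exact_mod_cast (Nat.choose_pos (by omega)).ne'
    have h3 := (ssProb_denom_pos (ε := ε) hs).ne'
    rw [hhi, hlo, one_sub_ssProb hs, ssProb, ← mul_div_assoc, div_eq_div_iff h2 h1, ← mul_div_assoc,
      div_mul_eq_mul_div, div_mul_eq_mul_div]
    congr 1
    linear_combination Real.exp ε * hc
  split_ifs with h h' h'
  · nlinarith
  · exact (key z' hz' h').le
  · have := key z hz h
    nlinarith
  · nlinarith

end SubsetSelection

/-! ### Padding of samples -/

section Samplers

universe u

variable {Y : Type u} [DecidableEq Y]

theorem bind_congr_support {M N : Type*} {p : PMF M} {f g : M → PMF N}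
    (h : ∀ x ∈ p.support, f x = g x) : p.bind f = p.bind g := by
  ext y
  rw [PMF.bind_apply, PMF.bind_apply]
  refine tsum_congr fun x => ?_
  by_cases hx : x ∈ p.support
  · rw [h x hx]
  · rw [(p.apply_eq_zero_iff x).2 hx, zero_mul, zero_mul]

theorem map_congr_support {M N : Type*} {p : PMF M} {f g : M → N}
    (h : ∀ x ∈ p.support, f x = g x) : p.map f = p.map g :=
  bind_congr_support fun x hx => by simp [h x hx]

theorem coe_padWithDummy {Z : Type*} (B : ℕ) (T : Finset Z) :
    (padWithDummy B T : Multiset (Option Z)) =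
      T.val.map some + Multiset.replicate (B - T.card) none := by
  rw [padWithDummy, ← Multiset.coe_add, ← Multiset.map_coe, Finset.coe_toList,
    Multiset.coe_replicate]

theorem exists_padWithDummy_eq_cons {B : ℕ} {T T' : Finset Y} (h : T' ⊆ T)
    (hcard : T.card ≤ T'.card + 1) (hB : T'.card ≤ B) :
    ∃ y, (padWithDummy (B + 1) T : Multiset (Option Y)) = y ::ₘ (padWithDummy B T' : Multiset _) := by
  rcases (Finset.card_le_card h).eq_or_lt with he | hlt
  · rw [← Finset.eq_of_subset_of_card_le h he.ge]
    refine ⟨none, ?_⟩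
    rw [coe_padWithDummy, coe_padWithDummy, Nat.sub_add_comm hB, Multiset.replicate_succ,
      Multiset.add_cons]
  · obtain ⟨y, hy, rfl⟩ := Finset.covBy_iff_exists_insert.1
      (Finset.covBy_iff_card_sdiff_eq_one.2 ⟨h, by rw [Finset.card_sdiff_of_subset h]; omega⟩)
    refine ⟨some y, ?_⟩
    rw [coe_padWithDummy, coe_padWithDummy, Finset.card_insert_of_notMem hy,
      Finset.insert_val_of_notMem hy, Multiset.map_cons, Multiset.cons_add, Nat.add_sub_add_right]

theorem padWithDummy_insert {B : ℕ} {T : Finset Y} {y : Y} (hy : y ∉ T) :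
    (padWithDummy (B + 1) (insert y T) : Multiset (Option Y)) =
      some y ::ₘ (padWithDummy B T : Multiset _) := by
  rw [coe_padWithDummy, coe_padWithDummy, Finset.card_insert_of_notMem hy,
    Finset.insert_val_of_notMem hy, Multiset.map_cons, Multiset.cons_add, Nat.add_sub_add_right]

/-! ### Greedy sampling -/

/-- Exactly `min B s.card` elements of `s` have fewer than `B` elements of `s` below them. -/
theorem card_filter_rank_lt {α β : Type*} [LinearOrder β] {f : α → β} (hf : f.Injective)
    (s : Finset α) (B : ℕ) :
    (s.filter fun z => (s.filter fun w => f w < f z).card < B).card = min B s.card := by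
  classical
  set rank : α → ℕ := fun z => (s.filter fun w => f w < f z).card with hrank
  have hlt : ∀ z w, z ∈ s → f z < f w → rank z < rank w := fun z w hz h => by
    refine Finset.card_lt_card ((Finset.ssubset_iff_of_subset fun x hx => ?_).2 ⟨z, ?_, ?_⟩)
    · rw [Finset.mem_filter] at hx ⊢
      exact ⟨hx.1, hx.2.trans h⟩
    · exact Finset.mem_filter.2 ⟨hz, h⟩
    · simp
  have hinj : Set.InjOn rank s := fun z hz w hw h => by
    by_contra hne
    rcases lt_or_gt_of_ne (hf.ne hne) with h' | h'
    · exact (hlt z w hz h').ne h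
    · exact (hlt w z hw h').ne' h
  have himg : s.image rank = Finset.range s.card := by
    refine Finset.eq_of_subset_of_card_le (fun k hk => ?_) ?_
    · obtain ⟨z, hz, rfl⟩ := Finset.mem_image.1 hk
      refine Finset.mem_range.2 (Finset.card_lt_card (Finset.filter_ssubset.2 ⟨z, hz, ?_⟩))
      simp
    · rw [Finset.card_range, Finset.card_image_of_injOn hinj]
  have h1 : (s.filter fun z => rank z < B).card = ((s.image rank).filter (· < B)).card := by
    rw [Finset.filter_image, Finset.card_image_of_injOn]
    exact hinj.mono (Finset.filter_subset _ _)
  rw [h1, himg, ← Finset.card_range (min B s.card)]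
  congr 1
  ext k
  simp [and_comm]

theorem topElements_subset (key : Y ↪ ℕ) (B : ℕ) (M : Multiset Y) :
    topElements key B M ⊆ M.toFinset := Finset.filter_subset _ _

theorem card_topElements (key : Y ↪ ℕ) (B : ℕ) (M : Multiset Y) :
    (topElements key B M).card = min B M.toFinset.card := by
  have := card_filter_rank_lt (f := fun z => toLex (-(M.count z : ℤ), key z))
    (fun z w h => key.injective (by simpa using (congrArg (fun x => (ofLex x).2) h)))
    M.toFinset B
  rw [← this, topElements]
  simp only [Prod.Lex.toLex_lt_toLex, neg_lt_neg_iff, neg_inj, Nat.cast_lt, Nat.cast_inj]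

/-- An element can be overtaken only by the added one. -/
theorem topElements_subset_cons (key : Y ↪ ℕ) (B : ℕ) (L : Multiset Y) (a : Y) :
    topElements key B L ⊆ topElements key (B + 1) (a ::ₘ L) := by
  intro z hz
  rw [topElements, Finset.mem_filter] at hz ⊢
  refine ⟨?_, ?_⟩
  · rw [Multiset.toFinset_cons]
    exact Finset.mem_insert_of_mem hz.1
  · refine lt_of_le_of_lt ?_ (Nat.add_lt_add_right hz.2 1)
    refine (Finset.card_le_card (t := insert a _) fun w hw => ?_).trans (Finset.card_insert_le _ _)
    rw [Finset.mem_filter, Multiset.toFinset_cons, Finset.mem_insert] at hw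
    obtain ⟨hw1, hw2⟩ := hw
    by_cases hwa : w = a
    · rw [hwa]; exact Finset.mem_insert_self _ _
    · refine Finset.mem_insert_of_mem (Finset.mem_filter.2 ⟨hw1.resolve_left hwa, ?_⟩)
      rw [Multiset.count_cons_of_ne hwa] at hw2
      by_cases hza : z = a
      · subst hza
        rw [Multiset.count_cons_self] at hw2
        exact Or.inl (by omega)
      · rwa [Multiset.count_cons_of_ne hza] at hw2

theorem topElements_subset_succ (key : Y ↪ ℕ) (B : ℕ) (L : Multiset Y) :
    topElements key B L ⊆ topElements key (B + 1) L := by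
  intro z hz
  rw [topElements, Finset.mem_filter] at hz ⊢
  exact ⟨hz.1, hz.2.trans (Nat.lt_succ_self B)⟩

theorem exists_greedy_eq_cons (key : Y ↪ ℕ) (B : ℕ) {L M : Multiset Y}
    (hM : M = L ∨ ∃ a, M = a ::ₘ L) :
    ∃ y, (padWithDummy (B + 1) (topElements key (B + 1) M) : Multiset (Option Y)) =
      y ::ₘ (padWithDummy B (topElements key B L) : Multiset _) := by
  refine exists_padWithDummy_eq_cons ?_ ?_ ?_
  · rcases hM with rfl | ⟨a, rfl⟩
    · exact topElements_subset_succ key B M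
    · exact topElements_subset_cons key B L a
  · rw [card_topElements, card_topElements]
    have : M.toFinset.card ≤ L.toFinset.card + 1 := by
      rcases hM with rfl | ⟨a, rfl⟩
      · exact Nat.le_succ _
      · rw [Multiset.toFinset_cons]; exact Finset.card_insert_le _ _
    omega
  · rw [card_topElements]; exact min_le_left _ _

/-! ### Uniformly random sampling -/

theorem eq_uniformSubset {k : ℕ} {S : Finset Y} {p : PMF (Finset Y)} {c : ENNReal}
    (h : ∀ T ∈ S.powersetCard (min k S.card), p T = c)
    (h' : ∀ T ∉ S.powersetCard (min k S.card), p T = 0) : p = uniformSubset k S := by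
  ext T
  rw [uniformSubset_apply]
  split_ifs with hT
  · have hsum := p.tsum_coe
    rw [tsum_eq_sum h', Finset.sum_congr rfl h, Finset.sum_const, Finset.card_powersetCard,
      nsmul_eq_mul] at hsum
    rw [h T hT]
    exact ENNReal.eq_inv_of_mul_eq_one_left (by rwa [mul_comm])
  · exact h' T hT

theorem uniformSubset_eq_pure {k : ℕ} {S : Finset Y} (h : S.card ≤ k) :
    uniformSubset k S = PMF.pure S := by
  refine (eq_uniformSubset (c := 1) ?_ ?_).symm <;> intro T <;>
    rw [min_eq_right h, Finset.powersetCard_self, Finset.mem_singleton, PMF.pure_apply] <;> simp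

theorem bind_map_insert_apply {p : PMF (Finset Y)} {κ : Finset Y → PMF Y}
    (h : ∀ C ∈ p.support, ∀ y ∈ C, κ C y = 0) (T : Finset Y) :
    (p.bind fun C => (κ C).map fun y => insert y C) T =
      ∑ y ∈ T, p (T.erase y) * κ (T.erase y) y := by
  simp only [PMF.bind_apply, PMF.map_apply, ← ENNReal.tsum_mul_left]
  rw [ENNReal.tsum_comm]
  have h1 : ∀ y, ∑' C, p C * (if T = insert y C then κ C y else 0) =
      if y ∈ T then p (T.erase y) * κ (T.erase y) y else 0 := fun y => by
    rw [tsum_eq_single (T.erase y)]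
    · by_cases hy : y ∈ T
      · rw [if_pos (Finset.insert_erase hy).symm, if_pos hy]
      · rw [if_neg, if_neg hy, mul_zero]
        intro he
        exact hy (he ▸ Finset.mem_insert_self _ _)
    · intro C hC
      split_ifs with he
      · by_cases hpC : C ∈ p.support
        · rw [h C hpC y, mul_zero]
          by_contra hy
          exact hC (by rw [he, Finset.erase_insert hy])
        · rw [(p.apply_eq_zero_iff C).2 hpC, zero_mul]
      · rw [mul_zero]
  refine (tsum_congr fun y => ?_ : _ =
    ∑' y, if y ∈ T then p (T.erase y) * κ (T.erase y) y else 0).trans ?_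
  · convert h1 y
  rw [tsum_eq_sum (s := T) fun y hy => if_neg hy]
  exact Finset.sum_congr rfl fun y hy => if_pos hy

/-- A random `(B + 1)`-subset of `S` or of `insert a S` is a random `B`-subset of `S` with one more
random element. -/
theorem exists_uniformSubset_succ_eq {B : ℕ} {S S' : Finset Y} (hB : B < S.card)
    (hS : S' = S ∨ ∃ a ∉ S, S' = insert a S) :
    ∃ κ : Finset Y → PMF Y, (∀ C ∈ (uniformSubset B S).support, ∀ y ∈ C, κ C y = 0) ∧
      uniformSubset (B + 1) S' = (uniformSubset B S).bind fun C => (κ C).map fun y => insert y C := by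
  -- The element `a` gets the weight of `B + 1` ordinary elements: a `(B + 1)`-subset without `a`
  -- arises in `B + 1` ways, one for each choice of the further element, but one with `a` in
  -- one way.
  obtain ⟨a, b, hab⟩ : ∃ a b, (b = 0 ∧ S' = S) ∨ (b = B + 1 ∧ a ∉ S ∧ S' = insert a S) := by
    rcases hS with h | ⟨a, ha, h⟩
    · obtain ⟨a, -⟩ := Finset.card_pos.1 (by omega : 0 < S.card)
      exact ⟨a, 0, Or.inl ⟨rfl, h⟩⟩
    · exact ⟨a, B + 1, Or.inr ⟨rfl, ha, h⟩⟩
  set m : Finset Y → Multiset Y := fun C => (S \ C).val + Multiset.replicate b a with hm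
  set κ : Finset Y → PMF Y := fun C => if h : m C = 0 then PMF.pure a else PMF.ofMultiset (m C) h
    with hκ
  have hP : ∀ C, C ∈ (uniformSubset B S).support ↔ C ∈ S.powersetCard B := fun C => by
    rw [PMF.mem_support_iff, uniformSubset_apply, min_eq_left hB.le]
    split_ifs with h
    · simp [h]
    · simp [h]
  have hmcard : ∀ C ∈ S.powersetCard B, (m C).card = S.card - B + b := fun C hC => by
    obtain ⟨h1, h2⟩ := Finset.mem_powersetCard.1 hC
    rw [hm, Multiset.card_add, Multiset.card_replicate, Finset.card_val,
      Finset.card_sdiff_of_subset h1, h2]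
  have hκa : ∀ C ∈ S.powersetCard B, ∀ y, κ C y =
      ((S \ C).val.count y + (Multiset.replicate b a).count y : ℕ) /
        ((S.card - B + b : ℕ) : ENNReal) := fun C hC y => by
    have : m C ≠ 0 := by
      rw [← Multiset.card_pos, hmcard C hC]; omega
    simp only [hκ]
    rw [dif_neg this, PMF.ofMultiset_apply, hmcard C hC, ← Multiset.count_add]
    congr!
  set K : ENNReal := ((S.card - B + b : ℕ) : ENNReal)
  have h0 : ∀ C ∈ S.powersetCard B, ∀ y ∈ C, κ C y = 0 := fun C hC y hy => by
    have h1 : (S \ C).val.count y = 0 :=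
        Multiset.count_eq_zero.2 (by rw [Finset.mem_val]; simp [hy])
    have h2 : (Multiset.replicate b a).count y = 0 := by
      rw [Multiset.count_replicate]
      rcases hab with ⟨rfl, -⟩ | ⟨-, ha, -⟩
      · simp
      · rw [if_neg]
        rintro rfl
        exact ha ((Finset.mem_powersetCard.1 hC).1 hy)
    rw [hκa C hC, h1, h2]
    simp
  have hU : ∀ C ∈ S.powersetCard B, uniformSubset B S C = (S.card.choose B : ENNReal)⁻¹ :=
    fun C hC => by rw [uniformSubset_apply, min_eq_left hB.le, if_pos hC]
  have hU0 : ∀ C ∉ S.powersetCard B, uniformSubset B S C = 0 := fun C hC => by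
    rw [uniformSubset_apply, min_eq_left hB.le, if_neg hC]
  have hsub : S ⊆ S' := by
    rcases hab with ⟨-, rfl⟩ | ⟨-, -, rfl⟩
    · exact subset_rfl
    · exact Finset.subset_insert _ _
  have hB' : min (B + 1) S'.card = B + 1 := min_eq_left (hB.trans_le (Finset.card_le_card hsub))
  have hsupp : ∀ C ∈ (uniformSubset B S).support, ∀ y ∈ C, κ C y = 0 := fun C hC =>
    h0 C ((hP C).1 hC)
  refine ⟨κ, hsupp, (eq_uniformSubset (c := (S.card.choose B : ENNReal)⁻¹ * ((B + 1 : ℕ) / K))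
    (fun T hT => ?_) fun T hT => ?_).symm⟩
  · rw [hB', Finset.mem_powersetCard] at hT
    rw [bind_map_insert_apply hsupp]
    by_cases hTS : T ⊆ S
    · have hterm : ∀ y ∈ T, uniformSubset B S (T.erase y) * κ (T.erase y) y =
          (S.card.choose B : ENNReal)⁻¹ * (1 / K) := fun y hy => by
        have hC : T.erase y ∈ S.powersetCard B := Finset.mem_powersetCard.2
          ⟨(Finset.erase_subset _ _).trans hTS, by rw [Finset.card_erase_of_mem hy, hT.2]; rfl⟩
        have h1 : (S \ T.erase y).val.count y = 1 :=
          Multiset.count_eq_one_of_mem (Finset.nodup _) (by rw [Finset.mem_val]; simp [hTS hy])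
        have h2 : (Multiset.replicate b a).count y = 0 := by
          rw [Multiset.count_replicate]
          rcases hab with ⟨rfl, -⟩ | ⟨-, ha, -⟩
          · simp
          · rw [if_neg]
            rintro rfl
            exact ha (hTS hy)
        rw [hU _ hC, hκa _ hC, h1, h2]
        simp [K]
      rw [Finset.sum_congr rfl hterm, Finset.sum_const, hT.2, nsmul_eq_mul]
      simp only [div_eq_mul_inv, one_mul]
      ring
    · rcases hab with ⟨-, rfl⟩ | ⟨rfl, ha, rfl⟩
      · exact absurd hT.1 hTS
      · have haT : a ∈ T := by
          by_contra h
          exact hTS ((Finset.subset_insert_iff_of_notMem h).1 hT.1)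
        have hC : T.erase a ∈ S.powersetCard B := Finset.mem_powersetCard.2
          ⟨Finset.subset_insert_iff.1 hT.1, by rw [Finset.card_erase_of_mem haT, hT.2]; rfl⟩
        rw [Finset.sum_eq_single_of_mem a haT, hU _ hC, hκa _ hC]
        · have h1 : (S \ T.erase a).val.count a = 0 :=
              Multiset.count_eq_zero.2 (by rw [Finset.mem_val]; simp [ha])
          rw [h1, Multiset.count_replicate_self, zero_add]
        · intro y _ hya
          rw [hU0, zero_mul]
          intro hC'
          exact ha ((Finset.mem_powersetCard.1 hC').1 (Finset.mem_erase.2 ⟨hya.symm, haT⟩))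
  · rw [hB', Finset.mem_powersetCard] at hT
    rw [bind_map_insert_apply hsupp]
    refine Finset.sum_eq_zero fun y hy => ?_
    by_cases hC : T.erase y ∈ S.powersetCard B
    · rw [hκa _ hC]
      have hC' := Finset.mem_powersetCard.1 hC
      have hTc : T.card = B + 1 := by
        rw [← hC'.2, Finset.card_erase_add_one hy]
      have hy' : y ∉ S' := fun h => hT ⟨by
        rw [← Finset.insert_erase hy]
        exact Finset.insert_subset h (hC'.1.trans hsub), hTc⟩
      have h1 : (S \ T.erase y).val.count y = 0 :=
        Multiset.count_eq_zero.2 (by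
            rw [Finset.mem_val]; exact fun h => hy' (hsub (Finset.mem_sdiff.1 h).1))
      have h2 : (Multiset.replicate b a).count y = 0 := by
        rw [Multiset.count_replicate]
        rcases hab with ⟨rfl, -⟩ | ⟨-, ha, rfl⟩
        · simp
        · rw [if_neg]
          rintro rfl
          exact hy' (Finset.mem_insert_self _ _)
      rw [h1, h2]
      simp
    · rw [hU0 _ hC, zero_mul]

/-- If `S` has at most `B` elements, both sides are deterministic and the further element may be the
dummy element. -/
theorem exists_random_eq {B : ℕ} {S S' : Finset Y} (hS : S' = S ∨ ∃ a ∉ S, S' = insert a S) :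
    ∃ κ : Finset Y → PMF (Option Y),
      (uniformSubset (B + 1) S').map (fun T => (padWithDummy (B + 1) T : Multiset (Option Y))) =
        (uniformSubset B S).bind fun C =>
          (κ C).map fun y => y ::ₘ (padWithDummy B C : Multiset (Option Y)) := by
  rcases lt_or_ge B S.card with hB | hB
  · obtain ⟨κ, hκ, he⟩ := exists_uniformSubset_succ_eq hB hS
    refine ⟨fun C => (κ C).map some, ?_⟩
    rw [he, PMF.map_bind]
    refine bind_congr_support fun C hC => ?_
    rw [PMF.map_comp, PMF.map_comp]
    refine map_congr_support fun y hy => padWithDummy_insert fun h => ?_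
    exact (PMF.mem_support_iff _ _).1 hy (hκ C hC y h)
  · have hsub : S ⊆ S' ∧ S'.card ≤ S.card + 1 := by
      rcases hS with rfl | ⟨a, ha, rfl⟩
      · exact ⟨subset_rfl, Nat.le_succ _⟩
      · exact ⟨Finset.subset_insert _ _, Finset.card_insert_le _ _⟩
    obtain ⟨y, hy⟩ := exists_padWithDummy_eq_cons hsub.1 hsub.2 hB
    refine ⟨fun _ => PMF.pure y, ?_⟩
    rw [uniformSubset_eq_pure hB, uniformSubset_eq_pure (by omega), PMF.pure_map, PMF.pure_bind,
      PMF.pure_map, hy]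

/-! ### The sensitivity of the samplers -/

/-- Adding one contribution changes at most one element of the sample: up to order, the sample is a
core drawn independently of the added contribution, together with one further element. -/
theorem exists_sample_eq_cons (smp : LocalSampler Y) (B : ℕ) (L : Multiset Y) :
    ∃ (Ω : Type u) (ρ : PMF Ω) (core : Ω → Multiset (Option Y)), ∀ M : Multiset Y,
      (M = L ∨ ∃ a, M = a ::ₘ L) → ∃ κ : Ω → PMF (Option Y),
        (smp.sample (B + 1) M).map Multiset.ofList =
          ρ.bind fun ω => (κ ω).map fun y => y ::ₘ core ω := by
  cases smp with
  | greedy tie =>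
    refine ⟨Y ↪ ℕ, tie, fun key => (padWithDummy B (topElements key B L) : Multiset (Option Y)),
      fun M hM => ?_⟩
    choose y hy using fun key : Y ↪ ℕ => exists_greedy_eq_cons key B hM
    refine ⟨fun key => PMF.pure (y key), ?_⟩
    simp only [LocalSampler.sample, PMF.map_comp, PMF.pure_map, ← hy]
    rfl
  | random =>
    refine ⟨Finset Y, uniformSubset B L.toFinset,
      fun C => (padWithDummy B C : Multiset (Option Y)), fun M hM => ?_⟩
    have hS : M.toFinset = L.toFinset ∨ ∃ a ∉ L.toFinset, M.toFinset = insert a L.toFinset := by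
      rcases hM with rfl | ⟨a, rfl⟩
      · exact Or.inl rfl
      · rw [Multiset.toFinset_cons]
        by_cases ha : a ∈ L.toFinset
        · exact Or.inl (Finset.insert_eq_of_mem ha)
        · exact Or.inr ⟨a, ha, rfl⟩
    obtain ⟨κ, hκ⟩ := exists_random_eq (B := B) hS
    refine ⟨κ, ?_⟩
    rw [← hκ]
    simp only [LocalSampler.sample, PMF.map_comp]
    rfl

/-- The sample consists of exactly `B` elements, each an element of the local dataset or the
dummy. -/
theorem mem_support_sample {smp : LocalSampler Y} {B : ℕ} {M : Multiset Y} {T : List (Option Y)}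
    (hT : T ∈ (smp.sample B M).support) :
    T.length = B ∧ ∀ x ∈ T, x ∈ Finset.insertNone M.toFinset := by
  have key : ∀ A : Finset Y, A ⊆ M.toFinset → A.card ≤ B → (padWithDummy B A).length = B ∧
      ∀ x ∈ padWithDummy B A, x ∈ Finset.insertNone M.toFinset := fun A hA hc => by
    constructor
    · rw [padWithDummy, List.length_append, List.length_map, Finset.length_toList,
        List.length_replicate]
      omega
    · intro x hx
      rw [padWithDummy, List.mem_append] at hx
      rcases hx with hx | hx
      · obtain ⟨y, hy, rfl⟩ := List.mem_map.1 hx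
        exact Finset.some_mem_insertNone.2 (hA (Finset.mem_toList.1 hy))
      · rw [List.eq_of_mem_replicate hx]
        exact Finset.none_mem_insertNone
  cases smp with
  | greedy tie =>
    obtain ⟨k, -, rfl⟩ := (PMF.mem_support_map_iff _ _ _).1 hT
    exact key _ (topElements_subset _ _ _) (by rw [card_topElements]; exact min_le_left _ _)
  | random =>
    obtain ⟨A, hA, rfl⟩ := (PMF.mem_support_map_iff _ _ _).1 hT
    rw [PMF.mem_support_iff, uniformSubset_apply] at hA
    split_ifs at hA with h
    · obtain ⟨h1, h2⟩ := Finset.mem_powersetCard.1 h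
      exact key A h1 (h2.trans_le (min_le_left _ _))
    · exact absurd rfl hA

end Samplers

/-! ### The layers of the algorithm -/

section TrieHH

variable {X U : Type*} [DecidableEq X]

/-- The law of the vote vector that reports one sampled element. -/
noncomputable def reportLaw (ε : ℝ) (𝒵 : Finset (List X)) (z : Option (List X)) :
    PMF (List X → ℕ) :=
  (subsetSelection ε (Finset.insertNone 𝒵) z).map (multiHot 𝒵)

/-- The amplification bound for subset selection reports of which one input is changed. -/
theorem dominatedBy_reports {ε δ : ℝ} (hε : 0 ≤ ε) (hδ : 0 ≤ δ) {n : ℕ} {𝒵 : Finset (List X)}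
    {y y' : Option (List X)} (hy : y ∈ Finset.insertNone 𝒵) (hy' : y' ∈ Finset.insertNone 𝒵)
    {l : List (Option (List X))} (hl : ∀ x ∈ l, x ∈ Finset.insertNone 𝒵) (hn : l.length + 1 = n) :
    DominatedBy (shuffleEps ε n δ) δ (indepSum (reportLaw ε 𝒵 y :: l.map (reportLaw ε 𝒵)))
      (indepSum (reportLaw ε 𝒵 y' :: l.map (reportLaw ε 𝒵))) := by
  have hf : ∀ x ∈ Finset.insertNone 𝒵, (reportLaw ε 𝒵 x).support.Finite := fun x hx => by
    rw [reportLaw, PMF.support_map]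
    exact (finite_support_subsetSelection hx).image _
  have hc : ∀ x ∈ Finset.insertNone 𝒵, ∀ x' ∈ Finset.insertNone 𝒵,
      PointwiseClose ε (reportLaw ε 𝒵 x) (reportLaw ε 𝒵 x') := fun x hx x' hx' =>
    (pointwiseClose_subsetSelection hε hx hx').map _
  refine dominatedBy_shuffleEps hε hδ fun t ht h =>
    dominatedBy_of_shufflePair hε ht hδ (hf y hy) (hf y' hy') ?_ (hc y hy y' hy') (hc y' hy' y hy)
      ?_ ?_ (by rwa [List.length_map, hn])
  all_goals
    intro q hq
    obtain ⟨x, hx, rfl⟩ := List.mem_map.1 hq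
  · exact hf x (hl x hx)
  · exact hc y hy x (hl x hx)
  · exact hc y' hy' x (hl x hx)

/-- A contribution adds at most one prefix to the local dataset of a layer. -/
theorem localPrefixes_cons (known 𝒵 : Finset (List X)) (i : ℕ) (z : List X)
    (M : Multiset (List X)) :
    localPrefixes known 𝒵 i (z ::ₘ M) = localPrefixes known 𝒵 i M ∨
      ∃ a, localPrefixes known 𝒵 i (z ::ₘ M) = a ::ₘ localPrefixes known 𝒵 i M := by
  unfold localPrefixes
  by_cases h : z ∈ known
  · left
    rw [Multiset.filter_cons_of_neg (p := fun z => z ∉ known) M (not_not.2 h)]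
  · rw [Multiset.filter_cons_of_pos (p := fun z => z ∉ known) M h, Multiset.map_cons]
    by_cases h' : z.take (i + 1) ∈ 𝒵
    · right
      exact ⟨_, Multiset.filter_cons_of_pos _ h'⟩
    · left
      rw [Multiset.filter_cons_of_neg _ h']

theorem toFinset_localPrefixes_subset (known 𝒵 : Finset (List X)) (i : ℕ)
    (M : Multiset (List X)) : (localPrefixes known 𝒵 i M).toFinset ⊆ 𝒵 := fun y hy => by
  rw [Multiset.mem_toFinset, localPrefixes, Multiset.mem_filter] at hy
  exact hy.2

variable [Fintype X]

theorem layer_eq_of_notMem {par : TrieParams X} {S S' : U → Multiset (List X)} {j : U}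
    (h : ∀ k, k ≠ j → S k = S' k) (i : ℕ) (P : Finset (List X)) {c : Finset U} (hj : j ∉ c) :
    layer par S i P c = layer par S' i P c := by
  unfold layer
  congr 2
  refine List.map_congr_left fun k hk => ?_
  rw [h k (by rintro rfl; exact hj (Finset.mem_toList.1 hk))]

variable [DecidableEq U]

theorem dominatedBy_layer {par : TrieParams X} (hε : 0 ≤ par.ε) (hB : 0 < par.B) {N n : ℕ}
    (hn : n = N * par.B) {δ : ℝ} (hδ : 0 ≤ δ) {S S' : U → Multiset (List X)} {j : U}
    {M : Multiset (List X)} {z z' : List X} (hS : S j = z ::ₘ M) (hS' : S' j = z' ::ₘ M)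
    (h : ∀ k, k ≠ j → S k = S' k) (i : ℕ) (P : Finset (List X)) {c : Finset U} (hc : c.card = N)
    (hj : j ∈ c) :
    DominatedBy (shuffleEps par.ε n δ) δ (layer par S i P c) (layer par S' i P c) := by
  unfold layer
  refine DominatedBy.map ?_ _
  set 𝒵 := extensions P
  obtain ⟨B, hB'⟩ : ∃ B, par.B = B + 1 := ⟨par.B - 1, by omega⟩
  set s : (U → Multiset (List X)) → U → PMF (List (Option (List X))) := fun S k =>
    par.sampler.sample par.B (localPrefixes par.known 𝒵 i (S k)) with hs
  have hvote : ∀ (S : U → Multiset (List X)) k,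
      userVote par i 𝒵 (S k) = voteLaw (reportLaw par.ε 𝒵) (s S k) := fun _ _ => rfl
  have hperm : ∀ S : U → Multiset (List X),
      indepSum (c.toList.map fun k => userVote par i 𝒵 (S k)) =
        indepSum (voteLaw (reportLaw par.ε 𝒵) (s S j) ::
          (c.erase j).toList.map fun k => voteLaw (reportLaw par.ε 𝒵) (s S k)) := fun S => by
    simp only [hvote]
    rw [← List.map_cons (f := fun k => voteLaw (reportLaw par.ε 𝒵) (s S k))]
    refine indepSum_perm (List.Perm.map _ ?_)
    conv_lhs => rw [← Finset.insert_erase hj]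
    exact Finset.toList_insert (Finset.notMem_erase j c)
  have hsame : (c.erase j).toList.map (fun k => voteLaw (reportLaw par.ε 𝒵) (s S' k)) =
      (c.erase j).toList.map fun k => voteLaw (reportLaw par.ε 𝒵) (s S k) := by
    refine List.map_congr_left fun k hk => ?_
    have hk' : k ≠ j := (Finset.mem_erase.1 (Finset.mem_toList.1 hk)).1
    simp only [hs, h k hk']
  rw [hperm, hperm, hsame]
  have hsupp : ∀ (S : U → Multiset (List X)) k, ∀ T ∈ (s S k).support,
      T.length = par.B ∧ ∀ x ∈ T, x ∈ Finset.insertNone 𝒵 := fun S k T hT => by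
    obtain ⟨h1, h2⟩ := mem_support_sample hT
    exact ⟨h1, fun x hx =>
      Finset.insertNone.monotone (toFinset_localPrefixes_subset _ _ _ _) (h2 x hx)⟩
  obtain ⟨Ω, ρ, core, hcore⟩ := exists_sample_eq_cons par.sampler B (localPrefixes par.known 𝒵 i M)
  obtain ⟨κ, hκ⟩ := hcore _ (localPrefixes_cons par.known 𝒵 i z M)
  obtain ⟨κ', hκ'⟩ := hcore _ (localPrefixes_cons par.known 𝒵 i z' M)
  rw [← hB', ← hS] at hκ
  rw [← hB', ← hS'] at hκ'
  refine dominatedBy_votes (Good := fun x => x ∈ Finset.insertNone 𝒵) (n := n) (B := par.B)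
    (fun y y' hy hy' l hl hlen => dominatedBy_reports hε hδ hy hy' hl hlen)
    (fun k _ => hsupp S k) ?_ hκ hκ' (hsupp S j) (hsupp S' j)
  rw [Finset.length_toList, Finset.card_erase_add_one hj, hc, hn]

/-- Once the user with the changed contribution has participated, the datasets agree on all users
that are still to be drawn. -/
theorem layers_eq_of_mem_used [Fintype U] {par : TrieParams X} {S S' : U → Multiset (List X)}
    {j : U} (h : ∀ k, k ≠ j → S k = S' k) {N : ℕ} {pick : Finset U → PMF (Finset U)}
    (hpick : PicksFreshCohorts N pick) (k i : ℕ) (used : Finset U)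
    (hcard : used.card + k * N ≤ Fintype.card U) (hj : j ∈ used) (P : Finset (List X)) :
    layers par pick S k i used P = layers par pick S' k i used P := by
  induction k generalizing i used P with
  | zero => rfl
  | succ k ih =>
    rw [add_mul, one_mul] at hcard
    simp only [layers]
    refine bind_congr_support fun c hc => ?_
    obtain ⟨hcN, hdisj⟩ := hpick used (by omega) c hc
    rw [layer_eq_of_notMem h i P (Finset.disjoint_right.1 hdisj hj)]
    have hcard' : (used ∪ c).card + k * N ≤ Fintype.card U := by
      have := Finset.card_union_le used c
      omega
    exact bind_congr_support fun P' _ => by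
      rw [ih (i + 1) (used ∪ c) hcard' (Finset.mem_union_left _ hj) P']

/-- The user with the changed contribution takes part in at most one layer; before and after it,
the two runs follow the same law. -/
theorem dominatedBy_layers [Fintype U] {par : TrieParams X} (hε : 0 ≤ par.ε) (hB : 0 < par.B)
    {N n : ℕ} (hn : n = N * par.B) {δ : ℝ} (hδ : 0 ≤ δ) {S S' : U → Multiset (List X)} {j : U}
    {M : Multiset (List X)} {z z' : List X} (hS : S j = z ::ₘ M) (hS' : S' j = z' ::ₘ M)
    (h : ∀ k, k ≠ j → S k = S' k) {pick : Finset U → PMF (Finset U)}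
    (hpick : PicksFreshCohorts N pick) (k i : ℕ) (used : Finset U)
    (hcard : used.card + k * N ≤ Fintype.card U) (P : Finset (List X)) :
    DominatedBy (shuffleEps par.ε n δ) δ (layers par pick S k i used P)
      (layers par pick S' k i used P) := by
  induction k generalizing i used P with
  | zero => exact DominatedBy.refl (Real.sInf_nonneg fun t ht => ht.1) _
  | succ k ih =>
    rw [add_mul, one_mul] at hcard
    simp only [layers]
    refine DominatedBy.bind_left fun c hc => ?_
    obtain ⟨hcN, hdisj⟩ := hpick used (by omega) c hc
    have hcard' : (used ∪ c).card + k * N ≤ Fintype.card U := by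
      have := Finset.card_union_le used c
      omega
    by_cases hjc : j ∈ c
    · have e : ∀ P', layers par pick S k (i + 1) (used ∪ c) P' =
          layers par pick S' k (i + 1) (used ∪ c) P' := fun P' =>
        layers_eq_of_mem_used h hpick k (i + 1) _ hcard' (Finset.mem_union_right _ hjc) P'
      simp only [e]
      exact (dominatedBy_layer hε hB hn hδ hS hS' h i P hcN hjc).bind _
    · rw [layer_eq_of_notMem h i P hjc]
      exact DominatedBy.bind_left fun P' _ => (ih (i + 1) (used ∪ c) hcard' P').map _

end TrieHH

theorem theorem2 {X U : Type*} [Fintype X] [DecidableEq X] [Fintype U] [DecidableEq U]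
    (par : TrieParams X) (hε : 0 ≤ par.ε) (hB : 0 < par.B) (hη : 0 < par.ηmax)
    (D N : ℕ) (hN : 0 < N) (hU : D * N ≤ Fintype.card U)
    (pick : Finset U → PMF (Finset U)) (hpick : PicksFreshCohorts N pick)
    (n : ℕ) (hn : n = N * par.B) (δ : ℝ) (hδ : 0 ≤ δ) (hδ' : δ ≤ 1) :
    IsDP ItemNeighbours (shuffleEps par.ε n δ) δ (trieHH par D pick) ∧
    (0 < δ → 0 < n / (8 * Real.log (2 / δ)) - 1 →
      par.ε ≤ Real.log (n / (8 * Real.log (2 / δ)) - 1) →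
      shuffleEps par.ε n δ ≤
        Real.log (1 + (Real.exp par.ε - 1) *
          (4 * √(2 * Real.log (4 / δ)) / √((Real.exp par.ε + 1) * n) + 4 / n))) := by
  constructor
  · rintro S S' ⟨j, M, z, z', hS, hS', h⟩
    exact (dominatedBy_layers hε hB hn hδ hS hS' h hpick D 1 ∅ (by simpa using hU) _).map _
  · intro hδ0 hpos hle
    have hn0 : 0 < n := hn ▸ Nat.mul_pos hN hB
    refine shuffleEps_le_log hε hn0 hδ0 hδ' ?_
    have hL : 0 < Real.log (2 / δ) :=
      Real.log_pos (by rw [lt_div_iff₀ hδ0]; linarith)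
    have h1 := (Real.le_log_iff_exp_le hpos).1 hle
    rw [le_sub_iff_add_le, le_div_iff₀ (by positivity)] at h1
    exact h1
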